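/- Let $\omega(x)=\frac{12}{\pi^{3/2}}\frac{1}{(1+|x|^2)^2}$ on $\mathbb R^6$ (also written $\omega(r)$, $r=|x|$), let $\Phi f(x)=\int_{\mathbb R^6}\frac{f(y)}{|x-y|^4}\,dy$, and let $$Lf=-\Delta f-\Phi(\omega^2)\,f-2\,\Phi(\omega f)\,\omega .$$ For $k\ge 0$ let $\mathcal H_k$ be the space of restrictions to the unit sphere $\mathbb S^5$ of real homogeneous harmonic polynomials of degree $k$ on $\mathbb R^6$, of dimension $\alpha_k$ ($\alpha_0=1$, $\alpha_1=6$, $\alpha_k=\binom{k+5}{k}-\binom{k+3}{k-2}$ for $k\ge2$), and let $(Y_{k,j})_{1\le j\le\alpha_k}$ be a basis of $\mathcal H_k$ with $\int_{\mathbb S^5}Y_{k,i}Y_{k,j}\,d\sigma=\pi^3\delta_{ij}$, where $\sigma$ is surface measure. For real-valued $f\in L^2(\mathbb R^6)$ put $f_{k,j}(r)=\frac1{\pi^3}\int_{\mathbb S^5}f(r\xi)Y_{k,j}(\xi)\,d\sigma(\xi)$. For $k\ge0$ and $t,r>0$ let $$\mathcal K_k(t,r)=\frac{2\pi^3}{k+2}\begin{cases}t^{k+5}/r^{k+4},&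 t<r,\\ r^k/t^{k-1},& t\ge r,\end{cases}$$ $$\mathcal L_kg(r)=-g''(r)-\frac5r g'(r)+\frac{k(k+4)}{r^2}g(r)-2\pi^{3/2}\omega(r)g(r)-2\,\omega(r)\int_0^\infty\mathcal K_k(t,r)\,\omega(t)\,g(t)\,dt .$$ **Theorem.** For every $f\in L^2(\mathbb R^6)$, $$Lf(x)=\sum_{k=0}^\infty\sum_{j=1}^{\alpha_k}(\mathcal L_kf_{k,j})(|x|)\,Y_{k,j}\!\left(\frac{x}{|x|}\right)$$ in the sense of tempered distributions on $\mathbb R^6$: derivatives are distributional, and for every real Schwartz function $\varphi$, $$\langle Lf,\varphi\rangle=\sum_{k=0}^\infty\sum_{j=1}^{\alpha_k}\Big\langle \mathcal L_kf_{k,j},\ r\mapsto r^5\!\int_{\mathbb S^5}\varphi(r\xi)Y_{k,j}(\xi)\,d\sigma(\xi)\Big\rangle ,$$ with the series over $k$ absolutely convergent. Here $$\langle Lf,\varphi\rangle=\int_{\mathbb R^6}\big[-f\,\Delta\varphi-(\Phi(\omega^2)f+2\Phi(\omega f)\omega)\varphi\big]dx,$$ $$\langle\mathcal L_kg,\theta\rangle=\int_0^\infty\Big[g\Big(-\theta''+\Big(\frac{5\theta}{r}\Big)'\Big)+\Big(\frac{k(k+4)}{r^2}g-2\pi^{3/2}\omega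 g-2\omega\int_0^\infty\mathcal K_k(t,r)\omega(t)g(t)\,dt\Big)\theta\Big]dr .$$ All objects here are well defined: $\Phi(\omega f)(x)$ converges absolutely for a.e. $x$; $f(r\,\cdot)\in L^2(\mathbb S^5)$ for a.e. $r>0$; $f_{k,j}\in L^2((0,\infty),r^5dr)$; $\int_0^\infty\mathcal K_k(t,r)\omega(t)f_{k,j}(t)\,dt$ converges absolutely for every $r>0$; and the integrals defining the pairings above converge absolutely. If moreover $f\in C^2(\mathbb R^6)$, the identity also holds with classical derivatives: $\Phi(\omega f)(x)$ converges absolutely for every $x$, every $f_{k,j}$ is $C^2$ on $(0,\infty)$, and for every $r>0$ one has $(Lf)(r\,\cdot)\in L^2(\mathbb S^5)$ and $(Lf)(r\xi)=\sum_{k}\sum_{j}(\mathcal L_kf_{k,j})(r)\,Y_{k,j}(\xi)$ with convergence in $L^2(\mathbb S^5,d\sigma(\xi))$. -/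

import Mathlib

open MeasureTheory Filter Topology
open scoped SchwartzMap Laplacian ENNReal

namespace Hartree

noncomputable section

/-- Six-dimensional Euclidean space. -/
abbrev R6 : Type := EuclideanSpace ℝ (Fin 6)

/-- The unit sphere of six-dimensional Euclidean space. -/
abbrev S5 : Type := Metric.sphere (0 : R6) 1

/-- Surface area measure on the unit sphere (total mass `π ^ 3`). -/
def surf : Measure S5 := (volume : Measure R6).toSphere

/-- Radial profile of the ground state: `ω(x) = omega ‖x‖`. -/
def omega (r : ℝ) : ℝ := 12 / Real.pi ^ (3 / 2 : ℝ) * (1 / (1 + r ^ 2) ^ 2)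

/-- The potential `Φ f (x) = ∫ f(y) / |x - y|⁴ dy`. -/
def Phi (f : R6 → ℝ) (x : R6) : ℝ := ∫ y, f y / ‖x - y‖ ^ 4

/-- The linearized operator
`L f = - Δ f - Φ(ω²) f - 2 Φ(ω f) ω`, with classical derivatives. -/
def L (f : R6 → ℝ) (x : R6) : ℝ :=
  -(Δ f x) - Phi (fun y => omega ‖y‖ ^ 2) x * f x
    - 2 * Phi (fun y => omega ‖y‖ * f y) x * omega ‖x‖

/-- The integrand of the distributional pairing `⟨L f, φ⟩`:
`⟨- Δ f, φ⟩ = - ∫ f Δ φ`, the other two terms of `L f` are functions. -/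
def weakLIntegrand (f : R6 → ℝ) (φ : 𝓢(R6, ℝ)) (x : R6) : ℝ :=
  -(f x * (Δ φ) x)
    + (-(Phi (fun y => omega ‖y‖ ^ 2) x * f x)
        - 2 * Phi (fun y => omega ‖y‖ * f y) x * omega ‖x‖) * φ x

/-- The distributional pairing `⟨L f, φ⟩`. -/
def weakL (f : R6 → ℝ) (φ : 𝓢(R6, ℝ)) : ℝ := ∫ x, weakLIntegrand f φ x

/-- The dimension of the space of spherical harmonics of degree `k`. -/
def alpha (k : ℕ) : ℕ :=
  if k = 0 then 1
  else if k = 1 then 6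
  else Nat.choose (k + 5) k - Nat.choose (k + 3) (k - 2)

/-- The Laplacian on polynomials in six variables. -/
def polyLaplacian : MvPolynomial (Fin 6) ℝ →ₗ[ℝ] MvPolynomial (Fin 6) ℝ :=
  ∑ i, (MvPolynomial.pderiv i).toLinearMap ∘ₗ (MvPolynomial.pderiv i).toLinearMap

/-- Restriction of a polynomial to the unit sphere. -/
def restrictSphere : MvPolynomial (Fin 6) ℝ →ₗ[ℝ] (S5 → ℝ) :=
  LinearMap.pi fun ξ => (MvPolynomial.aeval fun i => (ξ : R6) i).toLinearMap

/-- Spherical harmonics of degree `k`: the restrictions to the unit sphere of real homogeneous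
harmonic polynomials of degree `k`. -/
def sphericalHarmonics (k : ℕ) : Submodule ℝ (S5 → ℝ) :=
  (MvPolynomial.homogeneousSubmodule (Fin 6) ℝ k ⊓ LinearMap.ker polyLaplacian).map restrictSphere

/-- For each `k`, the functions `Y k j` form an orthogonal basis of the space of spherical
harmonics of degree `k`, normalized by `∫ (Y k j)² = π ^ 3`. -/
structure IsSphericalBasis (Y : (k : ℕ) → Fin (alpha k) → S5 → ℝ) : Prop where
  span_eq : ∀ k, Submodule.span ℝ (Set.range (Y k)) = sphericalHarmonics k
  orthogonal : ∀ k i j, ∫ ξ, Y k i ξ * Y k j ξ ∂surf = if i = j then Real.pi ^ 3 else 0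

/-- The spherical harmonics coefficient
`π⁻³ ∫ f(r ξ) Y(ξ) dσ(ξ)` of `f`, as a function of `r`. -/
def coeff (Y : S5 → ℝ) (f : R6 → ℝ) (r : ℝ) : ℝ :=
  1 / Real.pi ^ 3 * ∫ ξ, f (r • (ξ : R6)) * Y ξ ∂surf

/-- The measure `r⁵ dr` on `(0, ∞)`. -/
def radialMeasure : Measure ℝ :=
  (volume.restrict (Set.Ioi 0)).withDensity fun r => ENNReal.ofReal (r ^ 5)

/-- The kernel `K_k(t, r)`, for `t, r > 0`. -/
def kernelK (k : ℕ) (t r : ℝ) : ℝ :=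
  2 * Real.pi ^ 3 / ((k : ℝ) + 2) *
    if t < r then t ^ (k + 5) / r ^ (k + 4) else r ^ k / t ^ ((k : ℤ) - 1)

/-- The nonlocal part `∫₀^∞ K_k(t, r) ω(t) g(t) dt` of the radial operator. -/
def nonlocal (k : ℕ) (g : ℝ → ℝ) (r : ℝ) : ℝ :=
  ∫ t in Set.Ioi 0, kernelK k t r * omega t * g t

/-- The radial operator `𝓛_k`, with classical derivatives. -/
def radialL (k : ℕ) (g : ℝ → ℝ) (r : ℝ) : ℝ :=
  -(deriv (deriv g) r) - 5 / r * deriv g r + (k : ℝ) * (k + 4) / r ^ 2 * g r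
    - 2 * Real.pi ^ (3 / 2 : ℝ) * omega r * g r - 2 * omega r * nonlocal k g r

/-- The integrand of the distributional pairing `⟨𝓛_k g, θ⟩` on `(0, ∞)` with respect to `dr`:
`⟨-g'', θ⟩ = -∫ g θ''` and `⟨-(5/r) g', θ⟩ = ∫ g (5 θ / r)'`, the other terms are functions. -/
def weakRadialLIntegrand (k : ℕ) (g θ : ℝ → ℝ) (r : ℝ) : ℝ :=
  g r * (-(deriv (deriv θ) r) + deriv (fun s => 5 / s * θ s) r)
    + ((k : ℝ) * (k + 4) / r ^ 2 * g r - 2 * Real.pi ^ (3 / 2 : ℝ) * omega r * g r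
        - 2 * omega r * nonlocal k g r) * θ r

/-- The distributional pairing `⟨𝓛_k g, θ⟩` on `(0, ∞)` with respect to `dr`. -/
def weakRadialL (k : ℕ) (g θ : ℝ → ℝ) : ℝ :=
  ∫ r in Set.Ioi 0, weakRadialLIntegrand k g θ r

/-- The radial test function `r ↦ r⁵ ∫ φ(r ξ) Y(ξ) dσ(ξ)`. By polar coordinates, the
distribution `T(|x|) Y(x/|x|)` paired with `φ` is `T` paired with this function. -/
def sphereTest (Y : S5 → ℝ) (φ : R6 → ℝ) (r : ℝ) : ℝ :=
  r ^ 5 * ∫ ξ, φ (r • (ξ : R6)) * Y ξ ∂surf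

end

end Hartree

/-!
The operator `L` is a sum of operators that commute with rotations, so it acts on each space of
spherical harmonics separately; the proof identifies that action and sums it up with Parseval's
identity.

* *The Laplacian.* Infinitesimal rotations have integral zero over the sphere, hence the spherical
  Laplacian `sphLap` is symmetric (`integral_sphLap_mul`). It has the spherical harmonics of degree
  `k` as eigenfunctions, with eigenvalue `-k(k+4)` (`sphLap_polyFun`). Thus `Δ` acts on the
  coefficients of a `C²` function as `∂ᵣ² + 5/r ∂ᵣ - k(k+4)/r²` (`coeff_laplacian`).

* *The potential.* For a spherical harmonic `Z` of degree `k`, the integral of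
  `Z(ξ) |ξ - s η|⁻⁴` over the sphere solves the radial Laplace equation in `s ∈ (-1, 1)`, so it is a
  multiple of `sᵏ`. The multiple is found from the Poisson integral, which tends to `π³ Z(η)` as
  `s → 1`. This is the Funk–Hecke formula (`integral_kernel`), and Fubini's theorem turns it into
  `coeff_Phi`: `Φ` acts on the coefficients through the kernel `K_k`. For the radial function `ω²`
  the same formula gives `Φ(ω²) = 2 π^{3/2} ω` (`Phi_omega_sq`).

* *Square integrability.* Since `Φ(ω²)` is bounded, Schur's test shows that `f ↦ ω Φ(ω f)` is
  bounded on `L²` (`lintegral_schur`). Every term of `⟨L f, φ⟩` is therefore an inner product of two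
  functions in `L²`.

* *Completeness.* Every homogeneous polynomial coincides on the sphere with a sum of harmonic ones
  (`restrictSphere_mem_of_isHomogeneous`), so by the Stone–Weierstrass theorem the normalized
  spherical harmonics form a Hilbert basis of `L²` of the sphere. Integrated in polar coordinates,
  Parseval's identity becomes `hasSum_integral_coeff_mul`, which gives the weak decomposition once
  the derivatives are moved onto the test function. For `f` of class `C²`, the function `L f` is
  square integrable on each sphere, and its coefficients are `𝓛_k f_{k,j}` (`coeff_L`).
-/

open scoped RealInnerProductSpace Pointwise

namespace Hartree

noncomputable section

/-! ### Integration by parts on the unit sphere -/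

instance : IsFiniteMeasure surf := by unfold surf; infer_instance

lemma norm_S5 (ξ : S5) : ‖(ξ : R6)‖ = 1 := by simp

lemma surf_real_univ : surf.real Set.univ = Real.pi ^ 3 := by
  rw [surf, Measure.toSphere_real_apply_univ, measureReal_def, EuclideanSpace.volume_ball]
  have : Real.Gamma (6 / 2 + 1) = 6 := by
    rw [show (6 / 2 + 1 : ℝ) = (3 : ℕ) + 1 by norm_num, Real.Gamma_nat_eq_factorial]
    norm_num [Nat.factorial]
  have h2 : Real.sqrt Real.pi ^ 6 = Real.pi ^ 3 := by
    rw [show 6 = 2 * 3 by rfl, pow_mul, Real.sq_sqrt Real.pi_pos.le]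
  simp [this, h2]
  rw [ENNReal.toReal_ofReal (by positivity)]
  field_simp

/-- A linear isometry of `R6`, acting on the unit sphere. -/
def sphereMap (U : R6 ≃ₗᵢ[ℝ] R6) (ξ : S5) : S5 :=
  ⟨U ξ, by simp [U.norm_map]⟩

lemma continuous_sphereMap (U : R6 ≃ₗᵢ[ℝ] R6) : Continuous (sphereMap U) := by
  unfold sphereMap
  exact Continuous.subtype_mk (U.continuous.comp continuous_subtype_val) _

lemma injective_sphereMap (U : R6 ≃ₗᵢ[ℝ] R6) : Function.Injective (sphereMap U) :=
  fun _ _ h => Subtype.ext (U.injective (Subtype.ext_iff.1 h))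

lemma measurePreserving_sphereMap (U : R6 ≃ₗᵢ[ℝ] R6) :
    MeasurePreserving (sphereMap U) surf surf := by
  refine ⟨(continuous_sphereMap U).measurable, ?_⟩
  ext s hs
  have hU := (continuous_sphereMap U).measurable hs
  rw [Measure.map_apply (continuous_sphereMap U).measurable hs, surf,
    Measure.toSphere_apply' _ hU, Measure.toSphere_apply' _ hs]
  congr 1
  rw [← (U.measurePreserving).measure_preimage_emb U.toHomeomorph.measurableEmbedding
    (Set.Ioo (0 : ℝ) 1 • (Subtype.val '' s))]
  congr 1
  ext x
  simp only [Set.mem_smul, Set.mem_image, Set.mem_preimage]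
  constructor
  · rintro ⟨t, ht, -, ⟨ξ, hξ, rfl⟩, rfl⟩
    exact ⟨t, ht, _, ⟨_, hξ, rfl⟩, by simp [sphereMap]⟩
  · rintro ⟨t, ht, -, ⟨ξ, hξ, rfl⟩, h⟩
    refine ⟨t, ht, _, ⟨sphereMap U.symm ξ, ?_, rfl⟩, ?_⟩
    · have : sphereMap U (sphereMap U.symm ξ) = ξ := by
        apply Subtype.ext; simp [sphereMap]
      simpa [this] using hξ
    · apply U.injective
      simpa [sphereMap] using h

lemma integrable_surf {F : S5 → ℝ} (hF : Continuous F) : Integrable F surf :=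
  hF.integrable_of_hasCompactSupport (HasCompactSupport.of_compactSpace F)

/-- Differentiation under the integral sign over the sphere. -/
lemma hasDerivAt_integral_surf {U : Set ℝ} (hU : IsOpen U) {G G' : ℝ → S5 → ℝ}
    (hG : ∀ s ∈ U, Continuous (G s))
    (hG' : ContinuousOn (fun q : ℝ × S5 => G' q.1 q.2) (U ×ˢ Set.univ))
    (hd : ∀ s ∈ U, ∀ ξ, HasDerivAt (fun s => G s ξ) (G' s ξ) s) {s : ℝ} (hs : s ∈ U) :
    HasDerivAt (fun s => ∫ ξ, G s ξ ∂surf) (∫ ξ, G' s ξ ∂surf) s := by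
  obtain ⟨ε, hε, hball⟩ := Metric.nhds_basis_closedBall.mem_iff.1 (hU.mem_nhds hs)
  have hcomp : IsCompact (Metric.closedBall s ε ×ˢ (Set.univ : Set S5)) :=
    (isCompact_closedBall s ε).prod isCompact_univ
  obtain ⟨C, hC⟩ := hcomp.exists_bound_of_continuousOn
    (hG'.mono (Set.prod_mono hball subset_rfl))
  have hc : Continuous (G' s) :=
    hG'.comp_continuous (by fun_prop : Continuous fun ξ : S5 => (s, ξ)) (by simp [hs])
  refine (hasDerivAt_integral_of_dominated_loc_of_deriv_le (μ := surf) (bound := fun _ => C)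
    (Metric.closedBall_mem_nhds s hε) ?_ (integrable_surf (hG s hs))
    hc.aestronglyMeasurable ?_ (integrable_const C) ?_).2
  · filter_upwards [hU.mem_nhds hs] with t ht
    exact (hG t ht).aestronglyMeasurable
  · exact .of_forall fun ξ t ht => hC (t, ξ) ⟨ht, trivial⟩
  · exact .of_forall fun ξ t ht => hd t (hball ht) ξ

lemma continuousOn_integral_surf {U : Set ℝ} (hU : IsOpen U) {G : ℝ → S5 → ℝ}
    (hG : ContinuousOn (fun q : ℝ × S5 => G q.1 q.2) (U ×ˢ Set.univ)) :
    ContinuousOn (fun s => ∫ ξ, G s ξ ∂surf) U := by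
  intro s hs
  refine ContinuousAt.continuousWithinAt ?_
  obtain ⟨ε, hε, hball⟩ := Metric.nhds_basis_closedBall.mem_iff.1 (hU.mem_nhds hs)
  have hcomp : IsCompact (Metric.closedBall s ε ×ˢ (Set.univ : Set S5)) :=
    (isCompact_closedBall s ε).prod isCompact_univ
  obtain ⟨C, hC⟩ := hcomp.exists_bound_of_continuousOn
    (hG.mono (Set.prod_mono hball subset_rfl))
  refine continuousAt_of_dominated (bound := fun _ => C) ?_ ?_ (integrable_const C) ?_
  · filter_upwards [hU.mem_nhds hs] with t ht
    exact (hG.comp_continuous (by fun_prop : Continuous fun ξ : S5 => (t, ξ))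
      (by simp [ht])).aestronglyMeasurable
  · filter_upwards [Metric.closedBall_mem_nhds s hε] with t ht
    exact .of_forall fun ξ => hC (t, ξ) ⟨ht, trivial⟩
  · refine .of_forall fun ξ => ?_
    have := (hG (s, ξ) ⟨hs, trivial⟩).continuousAt
      ((hU.prod isOpen_univ).mem_nhds ⟨hs, trivial⟩)
    exact this.comp (f := fun t : ℝ => (t, ξ)) (by fun_prop)

/-- The infinitesimal rotation `x ↦ ⟨u, x⟩ v - ⟨v, x⟩ u`. -/
def skew (u v : R6) : R6 →L[ℝ] R6 :=
  (innerSL ℝ u).smulRight v - (innerSL ℝ v).smulRight u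

lemma skew_apply (u v x : R6) : skew u v x = ⟪u, x⟫ • v - ⟪v, x⟫ • u := rfl

/-- The rotation by the angle `θ` in the plane spanned by the orthonormal vectors `u`, `v`. -/
def rotation (u v : R6) (θ : ℝ) : R6 →L[ℝ] R6 :=
  ContinuousLinearMap.id ℝ R6
    + (Real.cos θ - 1) • ((innerSL ℝ u).smulRight u + (innerSL ℝ v).smulRight v)
    + Real.sin θ • skew u v

lemma rotation_apply (u v : R6) (θ : ℝ) (x : R6) : rotation u v θ x =
    x + (Real.cos θ - 1) • (⟪u, x⟫ • u + ⟪v, x⟫ • v)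
      + Real.sin θ • (⟪u, x⟫ • v - ⟪v, x⟫ • u) := rfl

lemma norm_rotation {u v : R6} (hu : ‖u‖ = 1) (hv : ‖v‖ = 1) (huv : ⟪u, v⟫ = 0) (θ : ℝ)
    (x : R6) : ‖rotation u v θ x‖ = ‖x‖ := by
  have huu : ⟪u, u⟫ = (1 : ℝ) := by rw [real_inner_self_eq_norm_sq, hu, one_pow]
  have hvv : ⟪v, v⟫ = (1 : ℝ) := by rw [real_inner_self_eq_norm_sq, hv, one_pow]
  have hvu : ⟪v, u⟫ = (0 : ℝ) := by rw [real_inner_comm, huv]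
  rw [← sq_eq_sq₀ (norm_nonneg _) (norm_nonneg _), ← real_inner_self_eq_norm_sq,
    ← real_inner_self_eq_norm_sq, rotation_apply]
  simp only [inner_add_left, inner_add_right, inner_sub_left, inner_sub_right,
    real_inner_smul_left, real_inner_smul_right, huu, hvv, huv, hvu, real_inner_comm u x,
    real_inner_comm v x]
  linear_combination (⟪u, x⟫ ^ 2 + ⟪v, x⟫ ^ 2) * Real.sin_sq_add_cos_sq θ

lemma integral_comp_rotation {u v : R6} (hu : ‖u‖ = 1) (hv : ‖v‖ = 1) (huv : ⟪u, v⟫ = 0)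
    (F : R6 → ℝ) (θ : ℝ) :
    ∫ ξ : S5, F (rotation u v θ ξ) ∂surf = ∫ ξ : S5, F ξ ∂surf := by
  let U : R6 ≃ₗᵢ[ℝ] R6 := LinearIsometry.toLinearIsometryEquiv
    ⟨(rotation u v θ).toLinearMap, norm_rotation hu hv huv θ⟩ rfl
  have hemb : MeasurableEmbedding (sphereMap U) :=
    (continuous_sphereMap U).measurableEmbedding
      (injective_sphereMap U)
  exact (measurePreserving_sphereMap U).integral_comp hemb (fun ξ : S5 => F ξ)

lemma hasDerivAt_rotation (u v x : R6) (θ : ℝ) :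
    HasDerivAt (fun θ => rotation u v θ x) (-Real.sin θ • (⟪u, x⟫ • u + ⟪v, x⟫ • v)
        + Real.cos θ • (⟪u, x⟫ • v - ⟪v, x⟫ • u)) θ := by
  simp only [rotation_apply]
  have hc := ((Real.hasDerivAt_cos θ).sub_const 1).smul_const (⟪u, x⟫ • u + ⟪v, x⟫ • v)
  have hs := (Real.hasDerivAt_sin θ).smul_const (⟪u, x⟫ • v - ⟪v, x⟫ • u)
  exact (hc.const_add x).add hs

lemma continuous_rotation (u v : R6) : Continuous fun q : ℝ × S5 => rotation u v q.1 q.2 := by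
  simp only [rotation_apply]; fun_prop

/-- Integration by parts on the sphere: infinitesimal rotations have integral zero, since the
surface measure is invariant under rotations. -/
lemma integral_fderiv_skew {V : Set R6} (hV : IsOpen V) (hS : Metric.sphere 0 1 ⊆ V) {F : R6 → ℝ}
    (hF : ContDiffOn ℝ 1 F V) {u v : R6} (hu : ‖u‖ = 1) (hv : ‖v‖ = 1) (huv : ⟪u, v⟫ = 0) :
    ∫ ξ : S5, fderiv ℝ F ξ (skew u v ξ) ∂surf = 0 := by
  have hmem : ∀ θ (ξ : S5), rotation u v θ ξ ∈ V := fun θ ξ => hS (by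
    simp [norm_rotation hu hv huv])
  have hcont := continuous_rotation u v
  have hcont1 : ∀ θ, Continuous fun ξ : S5 => rotation u v θ ξ := fun θ =>
    (rotation u v θ).continuous.comp continuous_subtype_val
  have hdF : ContinuousOn (fderiv ℝ F) V := hF.continuousOn_fderiv_of_isOpen hV le_rfl
  have hdF' : Continuous fun q : ℝ × S5 => fderiv ℝ F (rotation u v q.1 q.2) :=
    hdF.comp_continuous hcont fun q => hmem q.1 q.2
  have hw : Continuous fun q : ℝ × S5 => -Real.sin q.1 • (⟪u, (q.2 : R6)⟫ • u + ⟪v, (q.2 : R6)⟫ • v)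
      + Real.cos q.1 • (⟪u, (q.2 : R6)⟫ • v - ⟪v, (q.2 : R6)⟫ • u) := by fun_prop
  have h1 : ∀ θ (ξ : S5), HasFDerivAt F (fderiv ℝ F (rotation u v θ ξ)) (rotation u v θ ξ) :=
    fun θ ξ => ((hF.differentiableOn one_ne_zero).differentiableAt
      (hV.mem_nhds (hmem θ ξ))).hasFDerivAt
  have key := hasDerivAt_integral_surf isOpen_univ
    (G := fun θ ξ => F (rotation u v θ ξ))
    (G' := fun θ ξ => fderiv ℝ F (rotation u v θ ξ)
      (-Real.sin θ • (⟪u, (ξ : R6)⟫ • u + ⟪v, (ξ : R6)⟫ • v)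
        + Real.cos θ • (⟪u, (ξ : R6)⟫ • v - ⟪v, (ξ : R6)⟫ • u)))
    (fun θ _ => hF.continuousOn.comp_continuous (hcont1 θ) (hmem θ))
    (hdF'.clm_apply hw).continuousOn
    (fun θ _ ξ => (h1 θ ξ).comp_hasDerivAt θ (hasDerivAt_rotation u v ξ θ)) (Set.mem_univ 0)
  rw [funext (integral_comp_rotation hu hv huv F)] at key
  rw [← key.unique (hasDerivAt_const _ _)]
  congr 1
  funext ξ
  have h0 : rotation u v 0 ξ = ξ := by rw [rotation_apply]; simp
  rw [h0, skew_apply]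
  simp

/-- The Laplace–Beltrami operator of the spheres around the origin, at `x` multiplied by `‖x‖²` so
that it is rotation and dilation invariant. It is written as `‖x‖² Δ` minus the radial part
`‖x‖² (∂ᵣ² + 5/‖x‖ ∂ᵣ)`. -/
def sphLap (F : R6 → ℝ) (x : R6) : ℝ :=
  ‖x‖ ^ 2 * Δ F x - fderiv ℝ (fderiv ℝ F) x x x - 5 * fderiv ℝ F x x

lemma laplacian_eq_sum_fderiv (F : R6 → ℝ) (x : R6) :
    Δ F x = ∑ i, fderiv ℝ (fderiv ℝ F) x (EuclideanSpace.single i 1)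
      (EuclideanSpace.single i 1) := by
  rw [InnerProductSpace.laplacian_eq_iteratedFDeriv_orthonormalBasis F
    (EuclideanSpace.basisFun (Fin 6) ℝ)]
  simp [iteratedFDeriv_two_apply]

lemma fderiv_fderiv_clm {F : R6 → ℝ} {x : R6} (hF : ContDiffAt ℝ 2 F x) (A : R6 →L[ℝ] R6) :
    fderiv ℝ (fun y => fderiv ℝ F y (A y)) x (A x) =
      fderiv ℝ (fderiv ℝ F) x (A x) (A x) + fderiv ℝ F x (A (A x)) := by
  have h : DifferentiableAt ℝ (fderiv ℝ F) x :=
    (hF.fderiv_right (m := 1) (by norm_num)).differentiableAt one_ne_zero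
  rw [fderiv_clm_apply h A.differentiableAt]
  simp [add_comm]

/-- The sum of the squares of the infinitesimal rotations in the coordinate planes is the spherical
Laplacian; every plane is counted twice. -/
lemma sum_fderiv_skew {F : R6 → ℝ} {x : R6} (hF : ContDiffAt ℝ 2 F x) :
    ∑ i, ∑ j, fderiv ℝ (fun y => fderiv ℝ F y
        (skew (EuclideanSpace.single i 1) (EuclideanSpace.single j 1) y)) x
        (skew (EuclideanSpace.single i 1) (EuclideanSpace.single j 1) x) = 2 * sphLap F x := by
  have hx : x = ∑ i, x i • EuclideanSpace.single i (1 : ℝ) := by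
    have := (EuclideanSpace.basisFun (Fin 6) ℝ).sum_repr x
    simpa using this.symm
  have hn : ‖x‖ ^ 2 = ∑ i, x i ^ 2 := by simp [EuclideanSpace.norm_sq_eq]
  simp only [fderiv_fderiv_clm hF, sphLap, laplacian_eq_sum_fderiv]
  set H := fderiv ℝ (fderiv ℝ F) x
  set D := fderiv ℝ F x
  have hH : H x x = ∑ i, ∑ j, x i * x j *
      H (EuclideanSpace.single i 1) (EuclideanSpace.single j 1) := by
    have h1 : H x x = H (∑ i, x i • EuclideanSpace.single i (1 : ℝ))
      (∑ i, x i • EuclideanSpace.single i (1 : ℝ)) := by rw [← hx]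
    rw [h1]
    simp only [map_sum, map_smul, sum_apply, smul_apply,
      smul_eq_mul, Finset.mul_sum, mul_assoc]
    rw [Finset.sum_comm]
    refine Finset.sum_congr rfl fun i _ => Finset.sum_congr rfl fun j _ => by ring
  have hD : D x = ∑ i, x i * D (EuclideanSpace.single i 1) := by
    have h1 : D x = D (∑ i, x i • EuclideanSpace.single i (1 : ℝ)) := by rw [← hx]
    rw [h1]
    simp only [map_sum, map_smul, smul_eq_mul]
  have hA : ∀ i j : Fin 6, skew (EuclideanSpace.single i 1) (EuclideanSpace.single j 1) x =
      x i • EuclideanSpace.single j 1 - x j • EuclideanSpace.single i 1 := by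
    intro i j; simp [skew_apply, EuclideanSpace.inner_single_left]
  have hAA : ∀ i j : Fin 6, skew (EuclideanSpace.single i 1) (EuclideanSpace.single j 1)
      (skew (EuclideanSpace.single i 1) (EuclideanSpace.single j 1) x) =
      (if i = j then x i + x i else 0) • EuclideanSpace.single j (1 : ℝ)
        - x j • EuclideanSpace.single j 1 - x i • EuclideanSpace.single i 1 := by
    intro i j
    rw [hA]
    rcases eq_or_ne i j with rfl | h
    · simp [skew_apply, add_smul]
    · simp [skew_apply, EuclideanSpace.inner_single_left, h, h.symm]
  have h1 : ∀ i j : Fin 6, H (x i • EuclideanSpace.single j 1 - x j • EuclideanSpace.single i 1)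
      (x i • EuclideanSpace.single j 1 - x j • EuclideanSpace.single i 1) =
      x i ^ 2 * H (EuclideanSpace.single j 1) (EuclideanSpace.single j 1)
      + x j ^ 2 * H (EuclideanSpace.single i 1) (EuclideanSpace.single i 1)
      - x i * x j * H (EuclideanSpace.single i 1) (EuclideanSpace.single j 1)
      - x j * x i * H (EuclideanSpace.single j 1) (EuclideanSpace.single i 1) := by
    intro i j
    simp only [map_sub, map_smul, sub_apply, smul_apply,
      smul_eq_mul]
    ring
  simp only [hAA]
  simp only [hA, h1]
  simp only [map_sub, map_smul, smul_eq_mul, Finset.sum_add_distrib, Finset.sum_sub_distrib,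
    ite_mul, zero_mul, Finset.sum_ite_eq, Finset.mem_univ, if_true, add_mul,
    Finset.sum_const, Finset.card_univ, Fintype.card_fin, ← Finset.mul_sum, ← Finset.sum_mul,
    ← hD, nsmul_eq_mul]
  rw [Finset.sum_comm (f := fun i j => x j * x i * H (EuclideanSpace.single j 1)
    (EuclideanSpace.single i 1)), ← hH, ← hn]
  push_cast
  ring

/-- The spherical Laplacian is symmetric: for every infinitesimal rotation `A`, the difference
`(A² F) G - F (A² G)` is the derivative along `A` of `(A F) G - F (A G)`. -/
lemma integral_sphLap_mul {V : Set R6} (hV : IsOpen V) (hS : Metric.sphere 0 1 ⊆ V)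
    {F G : R6 → ℝ} (hF : ContDiffOn ℝ 2 F V) (hG : ContDiffOn ℝ 2 G V) :
    ∫ ξ : S5, sphLap F ξ * G ξ ∂surf = ∫ ξ : S5, F ξ * sphLap G ξ ∂surf := by
  have hmem : ∀ ξ : S5, (ξ : R6) ∈ V := fun ξ => hS ξ.2
  have hcd : ∀ {F : R6 → ℝ}, ContDiffOn ℝ 2 F V → ∀ A : R6 →L[ℝ] R6,
      ContDiffOn ℝ 1 (fun y => fderiv ℝ F y (A y)) V := fun {F} hF A =>
    (hF.fderiv_of_isOpen hV (m := 1) (by norm_num)).clm_apply A.contDiff.contDiffOn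
  have hcd0 : ∀ {F : R6 → ℝ}, ContDiffOn ℝ 1 F V → ∀ A : R6 →L[ℝ] R6,
      Continuous (fun ξ : S5 => fderiv ℝ F ξ (A ξ)) := fun {F} hF A =>
    ((hF.continuousOn_fderiv_of_isOpen hV le_rfl).comp_continuous continuous_subtype_val
      hmem).clm_apply (A.continuous.comp continuous_subtype_val)
  have hc0 : ∀ {F : R6 → ℝ}, ContDiffOn ℝ 1 F V → Continuous (fun ξ : S5 => F ξ) := fun {F} hF =>
    hF.continuousOn.comp_continuous continuous_subtype_val hmem
  have key : ∀ i j : Fin 6,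
      ∫ ξ : S5, (fderiv ℝ (fun y => fderiv ℝ F y
        (skew (EuclideanSpace.single i 1) (EuclideanSpace.single j 1) y)) ξ
        (skew (EuclideanSpace.single i 1) (EuclideanSpace.single j 1) ξ) * G ξ
      - F ξ * fderiv ℝ (fun y => fderiv ℝ G y
        (skew (EuclideanSpace.single i 1) (EuclideanSpace.single j 1) y)) ξ
        (skew (EuclideanSpace.single i 1) (EuclideanSpace.single j 1) ξ)) ∂surf = 0 := by
    intro i j
    rcases eq_or_ne i j with rfl | hij
    · simp [skew_apply]
    set A := skew (EuclideanSpace.single i 1) (EuclideanSpace.single j 1)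
    rw [← integral_fderiv_skew hV hS (F := fun y => fderiv ℝ F y (A y) * G y
      - F y * fderiv ℝ G y (A y)) (u := EuclideanSpace.single i 1)
      (v := EuclideanSpace.single j 1)
      (((hcd hF A).mul (hG.of_le one_le_two)).sub ((hF.of_le one_le_two).mul (hcd hG A)))
      (by simp) (by simp) (by simp [EuclideanSpace.inner_single_left, hij])]
    refine integral_congr_ae (.of_forall fun ξ => ?_)
    have hd : ∀ {F : R6 → ℝ}, ContDiffOn ℝ 1 F V → DifferentiableAt ℝ F ξ := fun {F} hF =>
      (hF.differentiableOn one_ne_zero).differentiableAt (hV.mem_nhds (hmem ξ))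
    have d1 := hd (hF.of_le one_le_two)
    have d2 := hd (hG.of_le one_le_two)
    have d3 := hd (hcd hF A)
    have d4 := hd (hcd hG A)
    simp only
    rw [fderiv_fun_sub (d3.fun_mul d2) (d1.fun_mul d4), fderiv_fun_mul d3 d2, fderiv_fun_mul d1 d4]
    simp only [sub_apply, add_apply,
      smul_apply, smul_eq_mul, A]
    ring
  have hint : ∀ i j : Fin 6,
      Integrable (fun ξ : S5 => fderiv ℝ (fun y => fderiv ℝ F y
        (skew (EuclideanSpace.single i 1) (EuclideanSpace.single j 1) y)) ξ
        (skew (EuclideanSpace.single i 1) (EuclideanSpace.single j 1) ξ) * G ξ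
      - F ξ * fderiv ℝ (fun y => fderiv ℝ G y
        (skew (EuclideanSpace.single i 1) (EuclideanSpace.single j 1) y)) ξ
        (skew (EuclideanSpace.single i 1) (EuclideanSpace.single j 1) ξ)) surf := fun i j =>
    integrable_surf (((hcd0 (hcd hF _) _).mul (hc0 (hG.of_le one_le_two))).sub
      ((hc0 (hF.of_le one_le_two)).mul (hcd0 (hcd hG _) _)))
  have hsum : ∀ ξ : S5, ∑ i, ∑ j, (fderiv ℝ (fun y => fderiv ℝ F y
        (skew (EuclideanSpace.single i 1) (EuclideanSpace.single j 1) y)) ξ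
        (skew (EuclideanSpace.single i 1) (EuclideanSpace.single j 1) ξ) * G ξ
      - F ξ * fderiv ℝ (fun y => fderiv ℝ G y
        (skew (EuclideanSpace.single i 1) (EuclideanSpace.single j 1) y)) ξ
        (skew (EuclideanSpace.single i 1) (EuclideanSpace.single j 1) ξ)) =
      2 * (sphLap F ξ * G ξ - F ξ * sphLap G ξ) := by
    intro ξ
    simp only [Finset.sum_sub_distrib, ← Finset.sum_mul, ← Finset.mul_sum]
    rw [sum_fderiv_skew (hF.contDiffAt (hV.mem_nhds (hmem ξ))),
      sum_fderiv_skew (hG.contDiffAt (hV.mem_nhds (hmem ξ)))]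
    ring
  have hcS : ∀ {F : R6 → ℝ}, ContDiffOn ℝ 2 F V → Continuous (fun ξ : S5 => sphLap F ξ) := by
    intro F hF
    have : (fun ξ : S5 => sphLap F ξ) = fun ξ : S5 => (1 / 2 : ℝ) *
      ∑ i, ∑ j, fderiv ℝ (fun y => fderiv ℝ F y
        (skew (EuclideanSpace.single i 1) (EuclideanSpace.single j 1) y)) ξ
        (skew (EuclideanSpace.single i 1) (EuclideanSpace.single j 1) ξ) := by
      funext ξ
      rw [sum_fderiv_skew (hF.contDiffAt (hV.mem_nhds (hmem ξ)))]
      ring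
    rw [this]
    exact continuous_const.mul (continuous_finsetSum _ fun i _ => continuous_finsetSum _ fun j _ =>
      hcd0 (hcd hF _) _)
  have h0 : ∫ ξ : S5, 2 * (sphLap F ξ * G ξ - F ξ * sphLap G ξ) ∂surf = 0 := by
    simp only [← hsum]
    rw [integral_finsetSum _ fun i _ => integrable_finsetSum _ fun j _ => hint i j]
    refine Finset.sum_eq_zero fun i _ => ?_
    rw [integral_finsetSum _ fun j _ => hint i j]
    exact Finset.sum_eq_zero fun j _ => key i j
  rw [integral_const_mul, integral_sub
    (integrable_surf (F := fun ξ : S5 => sphLap F ξ * G ξ)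
      ((hcS hF).mul (hc0 (hG.of_le one_le_two))))
    (integrable_surf (F := fun ξ : S5 => F ξ * sphLap G ξ)
      ((hc0 (hF.of_le one_le_two)).mul (hcS hG)))] at h0
  linarith

/-! ### The spherical Laplacian of harmonic polynomials -/

/-- The polynomial function on `R6` given by `p`. -/
def polyFun (p : MvPolynomial (Fin 6) ℝ) (x : R6) : ℝ := MvPolynomial.aeval (fun i => x i) p

lemma restrictSphere_apply (p : MvPolynomial (Fin 6) ℝ) (ξ : S5) :
    restrictSphere p ξ = polyFun p ξ := rfl

lemma polyFun_add (p q : MvPolynomial (Fin 6) ℝ) (x : R6) :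
    polyFun (p + q) x = polyFun p x + polyFun q x := map_add _ _ _

lemma polyFun_mul (p q : MvPolynomial (Fin 6) ℝ) (x : R6) :
    polyFun (p * q) x = polyFun p x * polyFun q x := map_mul _ _ _

lemma polyFun_X (i : Fin 6) (x : R6) : polyFun (MvPolynomial.X i) x = x i := by simp [polyFun]

lemma polyFun_C (a : ℝ) (x : R6) : polyFun (MvPolynomial.C a) x = a := by simp [polyFun]

lemma polyFun_sum {ι : Type*} (s : Finset ι) (p : ι → MvPolynomial (Fin 6) ℝ) (x : R6) :
    polyFun (∑ i ∈ s, p i) x = ∑ i ∈ s, polyFun (p i) x := map_sum _ _ _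

lemma hasFDerivAt_polyFun (p : MvPolynomial (Fin 6) ℝ) (x : R6) :
    HasFDerivAt (polyFun p) (∑ i, polyFun (MvPolynomial.pderiv i p) x •
      (EuclideanSpace.proj i : R6 →L[ℝ] ℝ)) x := by
  induction p using MvPolynomial.induction_on with
  | C a =>
    have : polyFun (MvPolynomial.C a) = fun _ => a := funext (polyFun_C a)
    rw [this]
    simpa [MvPolynomial.pderiv_C, polyFun] using hasFDerivAt_const a x
  | add p q hp hq =>
    have : polyFun (p + q) = fun x => polyFun p x + polyFun q x := funext (polyFun_add p q)
    rw [this]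
    refine (hp.add hq).congr_fderiv ?_
    simp [polyFun_add, add_smul, Finset.sum_add_distrib]
  | mul_X p j hp =>
    have : polyFun (p * MvPolynomial.X j) = fun x => polyFun p x * x j :=
      funext fun x => by rw [polyFun_mul, polyFun_X]
    rw [this]
    refine (hp.mul (EuclideanSpace.proj j : R6 →L[ℝ] ℝ).hasFDerivAt).congr_fderiv ?_
    simp only [Derivation.leibniz, smul_eq_mul, polyFun_add, polyFun_mul, polyFun_X,
      MvPolynomial.pderiv_X, add_smul, Finset.sum_add_distrib, Finset.smul_sum, mul_smul]
    congr 1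
    rw [Finset.sum_eq_single j]
    · simp [polyFun]
    · intro i _ hi
      simp [polyFun, hi.symm]
    · simp

lemma contDiff_polyFun (p : MvPolynomial (Fin 6) ℝ) {n : WithTop ℕ∞} :
    ContDiff ℝ n (polyFun p) := by
  induction p using MvPolynomial.induction_on with
  | C a => rw [show polyFun (MvPolynomial.C a) = fun _ => a from funext (polyFun_C a)]; fun_prop
  | add p q hp hq =>
    rw [show polyFun (p + q) = fun x => polyFun p x + polyFun q x from funext (polyFun_add p q)]
    exact hp.add hq
  | mul_X p j hp =>
    rw [show polyFun (p * MvPolynomial.X j) = fun x => polyFun p x * x j from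
      funext fun x => by rw [polyFun_mul, polyFun_X]]
    exact hp.mul (EuclideanSpace.proj j : R6 →L[ℝ] ℝ).contDiff

lemma fderiv_polyFun_single (p : MvPolynomial (Fin 6) ℝ) (x : R6) (i : Fin 6) :
    fderiv ℝ (polyFun p) x (EuclideanSpace.single i 1) = polyFun (MvPolynomial.pderiv i p) x := by
  rw [(hasFDerivAt_polyFun p x).fderiv]
  simp

lemma laplacian_polyFun (p : MvPolynomial (Fin 6) ℝ) (x : R6) :
    Δ (polyFun p) x = polyFun (polyLaplacian p) x := by
  rw [laplacian_eq_sum_fderiv, polyLaplacian, LinearMap.sum_apply, polyFun_sum]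
  refine Finset.sum_congr rfl fun i _ => ?_
  have h : DifferentiableAt ℝ (fderiv ℝ (polyFun p)) x :=
    ((contDiff_polyFun p (n := 2)).fderiv_right (m := 1) (by norm_num)).contDiffAt.differentiableAt
      one_ne_zero
  have h2 := fderiv_clm_apply h
    (differentiableAt_const (EuclideanSpace.single i (1 : ℝ) : R6))
  simp only [fderiv_polyFun_single] at h2
  have h3 := congrArg (fun T => T (EuclideanSpace.single i (1 : ℝ))) h2
  simp only [fderiv_polyFun_single] at h3
  simpa using h3.symm

/-- Euler's identity. -/
lemma fderiv_polyFun_self {p : MvPolynomial (Fin 6) ℝ} {k : ℕ} (hp : p.IsHomogeneous k) (x : R6) :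
    fderiv ℝ (polyFun p) x x = k * polyFun p x := by
  have h := congrArg (fun q => polyFun q x) hp.sum_X_mul_pderiv
  simp only [polyFun_sum, polyFun_mul, polyFun_X] at h
  rw [(hasFDerivAt_polyFun p x).fderiv]
  have h2 : polyFun (k • p) x = k * polyFun p x := by simp [polyFun]
  rw [← h2, ← h]
  simp [mul_comm]

lemma fderiv_fderiv_self {F : R6 → ℝ} {x : R6} (hF : ContDiffAt ℝ 2 F x) :
    fderiv ℝ (fun y => fderiv ℝ F y y) x x = fderiv ℝ (fderiv ℝ F) x x x + fderiv ℝ F x x := by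
  simpa using fderiv_fderiv_clm hF (ContinuousLinearMap.id ℝ R6)

/-- Harmonic homogeneous polynomials are eigenfunctions of the spherical Laplacian. -/
lemma sphLap_polyFun {p : MvPolynomial (Fin 6) ℝ} {k : ℕ} (hp : p.IsHomogeneous k)
    (hh : polyLaplacian p = 0) (x : R6) :
    sphLap (polyFun p) x = -((k : ℝ) * (k + 4)) * polyFun p x := by
  have h := fderiv_fderiv_self (contDiff_polyFun p (n := 2)).contDiffAt (x := x)
  have h2 : (fun y => fderiv ℝ (polyFun p) y y) = fun y => (k : ℝ) * polyFun p y :=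
    funext (fderiv_polyFun_self hp)
  have h3 : fderiv ℝ (fun y => (k : ℝ) * polyFun p y) x x = k * (k * polyFun p x) := by
    rw [fderiv_const_mul ((contDiff_polyFun p (n := 2)).differentiable two_ne_zero x)]
    simp [fderiv_polyFun_self hp]
  rw [h2, h3, fderiv_polyFun_self hp] at h
  rw [sphLap, laplacian_polyFun, hh, fderiv_polyFun_self hp]
  have : polyFun 0 x = 0 := map_zero _
  rw [this]
  linear_combination h

lemma contDiff_smul_comp {F : R6 → ℝ} {n : WithTop ℕ∞} (hF : ContDiff ℝ n F) (r : ℝ) :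
    ContDiff ℝ n (fun x => F (r • x)) := hF.comp (contDiff_const_smul r)

lemma fderiv_smul_comp {G : Type*} [NormedAddCommGroup G] [NormedSpace ℝ G] {F : R6 → G}
    (r : ℝ) (x : R6) (hF : DifferentiableAt ℝ F (r • x)) :
    fderiv ℝ (fun x => F (r • x)) x = r • fderiv ℝ F (r • x) := by
  have h : HasFDerivAt (fun x : R6 => r • x) (r • ContinuousLinearMap.id ℝ R6) x :=
    (hasFDerivAt_id x).const_smul r
  have h3 : HasFDerivAt (fun x => F (r • x)) _ x := HasFDerivAt.comp x hF.hasFDerivAt h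
  rw [h3.fderiv]
  ext y; simp

lemma sphLap_smul_comp {F : R6 → ℝ} (hF : ContDiff ℝ 2 F) (r : ℝ) (x : R6) :
    sphLap (fun x => F (r • x)) x = sphLap F (r • x) := by
  have h1 : fderiv ℝ (fun x => F (r • x)) = fun x => r • fderiv ℝ F (r • x) :=
    funext fun y => fderiv_smul_comp r y (hF.differentiable two_ne_zero _)
  have hd : Differentiable ℝ (fderiv ℝ F) :=
    (hF.fderiv_right (m := 1) (by norm_num)).differentiable one_ne_zero
  have h2 : fderiv ℝ (fderiv ℝ (fun x => F (r • x))) x = r • r • fderiv ℝ (fderiv ℝ F) (r • x) := by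
    have hd' : DifferentiableAt ℝ (fun x => fderiv ℝ F (r • x)) x :=
      DifferentiableAt.comp x (hd _) (differentiableAt_id.const_smul r)
    rw [h1, fderiv_fun_const_smul hd', fderiv_smul_comp r x (hd _)]
  simp only [sphLap, laplacian_eq_sum_fderiv, h2]
  simp only [h1, norm_smul, smul_apply, map_smul, smul_eq_mul,
    ← Finset.mul_sum, mul_pow, Real.norm_eq_abs, sq_abs]
  ring

/-! ### The Newtonian potential of a spherical harmonic inside the ball -/

/-- For unit vectors `η`, `x`, the squared distance between `x` and `s • η`. The formula makes it an
affine function of `x` on the whole space. -/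
def distSq (η : R6) (s : ℝ) (x : R6) : ℝ := 1 + s ^ 2 - 2 * s * ⟪η, x⟫

lemma abs_inner_S5_le (η ξ : S5) : |⟪(η : R6), (ξ : R6)⟫| ≤ 1 := by
  simpa [norm_S5] using abs_real_inner_le_norm (η : R6) (ξ : R6)

lemma distSq_pos (η ξ : S5) {s : ℝ} (hs : s ∈ Set.Ioo (-1 : ℝ) 1) : 0 < distSq η s ξ := by
  have h := abs_le.1 (abs_inner_S5_le η ξ)
  unfold distSq
  rcases le_total 0 s with h0 | h0
  · nlinarith [hs.1, hs.2, mul_le_mul_of_nonneg_left h.2 h0]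
  · nlinarith [hs.1, hs.2, mul_le_mul_of_nonpos_left h.1 h0]

lemma continuous_distSq (η : R6) : Continuous fun q : ℝ × S5 => distSq η q.1 q.2 := by
  unfold distSq; fun_prop

lemma hasDerivAt_inv_distSq_pow {η x : R6} {s : ℝ} (m : ℕ) (h : distSq η s x ≠ 0) :
    HasDerivAt (fun s => (distSq η s x ^ m)⁻¹)
      (-(m * (2 * s - 2 * ⟪η, x⟫)) * (distSq η s x ^ (m + 1))⁻¹) s := by
  have h1 : HasDerivAt (fun s => distSq η s x) (2 * s - 2 * ⟪η, x⟫) s := by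
    have a := ((hasDerivAt_pow 2 s).const_add 1).sub
      (((hasDerivAt_id s).const_mul 2).mul_const ⟪η, x⟫)
    refine (a.congr_deriv ?_)
    simp
  refine ((h1.fun_pow m).fun_inv (pow_ne_zero _ h)).congr_deriv ?_
  rcases m with _ | m
  · simp
  · simp only [Nat.add_sub_cancel]
    field_simp
    ring

/-- The spherical Laplacian of a function of one coordinate. -/
lemma sphLap_comp_inner {η : R6} {V : Set R6} (hV : IsOpen V) {v v' v'' : ℝ → ℝ}
    (h1 : ∀ x ∈ V, HasDerivAt v (v' ⟪η, x⟫) ⟪η, x⟫)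
    (h2 : ∀ x ∈ V, HasDerivAt v' (v'' ⟪η, x⟫) ⟪η, x⟫) {x : R6} (hx : x ∈ V) :
    sphLap (fun y => v ⟪η, y⟫) x =
      (‖x‖ ^ 2 * ‖η‖ ^ 2 - ⟪η, x⟫ ^ 2) * v'' ⟪η, x⟫ - 5 * ⟪η, x⟫ * v' ⟪η, x⟫ := by
  have d0 : ∀ y : R6, HasFDerivAt (fun y : R6 => ⟪η, y⟫) (innerSL ℝ η) y := fun y =>
    (innerSL ℝ η).hasFDerivAt
  have d1 : ∀ y ∈ V, HasFDerivAt (fun y => v ⟪η, y⟫) (v' ⟪η, y⟫ • innerSL ℝ η) y := fun y hy =>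
    (h1 y hy).comp_hasFDerivAt y (d0 y)
  have e1 : fderiv ℝ (fun y => v ⟪η, y⟫) =ᶠ[𝓝 x] fun y => v' ⟪η, y⟫ • innerSL ℝ η := by
    filter_upwards [hV.mem_nhds hx] with y hy using (d1 y hy).fderiv
  have d2 : HasFDerivAt (fun y => v' ⟪η, y⟫ • innerSL ℝ η)
      ((v'' ⟪η, x⟫ • innerSL ℝ η).smulRight (innerSL ℝ η)) x :=
    ((h2 x hx).comp_hasFDerivAt x (d0 x)).smul_const (innerSL ℝ η)
  have e2 : fderiv ℝ (fderiv ℝ (fun y => v ⟪η, y⟫)) x =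
      (v'' ⟪η, x⟫ • innerSL ℝ η).smulRight (innerSL ℝ η) := by
    rw [e1.fderiv_eq, d2.fderiv]
  rw [sphLap, laplacian_eq_sum_fderiv, e2, (d1 x hx).fderiv]
  have hn : ‖η‖ ^ 2 = ∑ i, η i ^ 2 := by simp [EuclideanSpace.norm_sq_eq]
  rw [hn]
  simp [EuclideanSpace.inner_single_right, Finset.mul_sum, Finset.sum_mul, sub_mul]
  congr 1
  · congr 1
    · exact Finset.sum_congr rfl fun i _ => by ring
    · ring
  · ring

lemma hasDerivAt_inv_linear_pow {s u : ℝ} (m : ℕ) (h : 1 + s ^ 2 - 2 * s * u ≠ 0) :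
    HasDerivAt (fun u => ((1 + s ^ 2 - 2 * s * u) ^ m)⁻¹)
      (m * (2 * s) * ((1 + s ^ 2 - 2 * s * u) ^ (m + 1))⁻¹) u := by
  generalize hD : 1 + s ^ 2 - 2 * s * u = D at h
  have h1 : HasDerivAt (fun u => 1 + s ^ 2 - 2 * s * u) (-(2 * s)) u := by
    simpa using ((hasDerivAt_id u).const_mul (2 * s)).const_sub (1 + s ^ 2)
  refine ((h1.fun_pow m).fun_inv (pow_ne_zero _ (hD ▸ h))).congr_deriv ?_
  simp only [hD]
  rcases m with _ | m
  · simp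
  · simp only [Nat.add_sub_cancel]
    field_simp
    ring

section
variable {p : MvPolynomial (Fin 6) ℝ} {k : ℕ} (η : S5)

/-- The Newtonian potential at `s • η` of the density `p` on the unit sphere. -/
def spherePot (p : MvPolynomial (Fin 6) ℝ) (η : R6) (s : ℝ) : ℝ :=
  ∫ ξ : S5, polyFun p ξ * (distSq η s ξ ^ 2)⁻¹ ∂surf

/-- The first derivative of `spherePot` in the radial variable. -/
def spherePot' (p : MvPolynomial (Fin 6) ℝ) (η : R6) (s : ℝ) : ℝ :=
  ∫ ξ : S5, polyFun p ξ * (-(4 * (s - ⟪η, (ξ : R6)⟫)) * (distSq η s ξ ^ 3)⁻¹) ∂surf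

/-- The second derivative of `spherePot` in the radial variable. -/
def spherePot'' (p : MvPolynomial (Fin 6) ℝ) (η : R6) (s : ℝ) : ℝ :=
  ∫ ξ : S5, polyFun p ξ * (24 * (s - ⟪η, (ξ : R6)⟫) ^ 2 * (distSq η s ξ ^ 4)⁻¹
    - 4 * (distSq η s ξ ^ 3)⁻¹) ∂surf

lemma continuous_polyFun_S5 (p : MvPolynomial (Fin 6) ℝ) : Continuous fun ξ : S5 => polyFun p ξ :=
  (contDiff_polyFun p (n := 0)).continuous.comp continuous_subtype_val

lemma continuousOn_inv_distSq (m : ℕ) :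
    ContinuousOn (fun q : ℝ × S5 => (distSq η q.1 q.2 ^ m)⁻¹)
      (Set.Ioo (-1 : ℝ) 1 ×ˢ Set.univ) :=
  ContinuousOn.inv₀ ((continuous_distSq η).pow m).continuousOn fun q hq =>
    pow_ne_zero _ (distSq_pos η q.2 hq.1).ne'

lemma continuous_inv_distSq {s : ℝ} (hs : s ∈ Set.Ioo (-1 : ℝ) 1) (m : ℕ) :
    Continuous (fun ξ : S5 => (distSq η s ξ ^ m)⁻¹) :=
  (continuousOn_inv_distSq η m).comp_continuous (by fun_prop : Continuous fun ξ : S5 => (s, ξ))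
    fun ξ => ⟨hs, trivial⟩

lemma continuous_inner_S5 : Continuous fun ξ : S5 => ⟪(η : R6), (ξ : R6)⟫ :=
  (innerSL ℝ (η : R6)).continuous.comp continuous_subtype_val

lemma continuous_kernel_deriv {s : ℝ} (hs : s ∈ Set.Ioo (-1 : ℝ) 1) : Continuous fun ξ : S5 =>
    -(4 * (s - ⟪(η : R6), (ξ : R6)⟫)) * (distSq η s ξ ^ 3)⁻¹ :=
  (continuous_const.mul (continuous_const.sub (continuous_inner_S5 η))).neg.mul
    (continuous_inv_distSq η hs 3)

lemma continuous_kernel_deriv2 {s : ℝ} (hs : s ∈ Set.Ioo (-1 : ℝ) 1) : Continuous fun ξ : S5 =>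
    24 * (s - ⟪(η : R6), (ξ : R6)⟫) ^ 2 * (distSq η s ξ ^ 4)⁻¹ - 4 * (distSq η s ξ ^ 3)⁻¹ :=
  ((continuous_const.mul ((continuous_const.sub (continuous_inner_S5 η)).pow 2)).mul
    (continuous_inv_distSq η hs 4)).sub (continuous_const.mul (continuous_inv_distSq η hs 3))

lemma continuous_inner_prod : Continuous fun q : ℝ × S5 => q.1 - ⟪(η : R6), (q.2 : R6)⟫ :=
  continuous_fst.sub ((continuous_inner_S5 η).comp continuous_snd)

lemma hasDerivAt_spherePot {s : ℝ} (hs : s ∈ Set.Ioo (-1 : ℝ) 1) :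
    HasDerivAt (spherePot p η) (spherePot' p η s) s := by
  refine hasDerivAt_integral_surf isOpen_Ioo
    (G := fun s ξ => polyFun p ξ * (distSq η s ξ ^ 2)⁻¹)
    (G' := fun s ξ => polyFun p ξ * (-(4 * (s - ⟪(η : R6), (ξ : R6)⟫)) * (distSq η s ξ ^ 3)⁻¹))
    (fun s hs => (continuous_polyFun_S5 p).mul (continuous_inv_distSq η hs 2)) ?_ ?_ hs
  · refine ((continuous_polyFun_S5 p).comp continuous_snd).continuousOn.mul
      (ContinuousOn.mul ?_ (continuousOn_inv_distSq η 3))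
    exact (continuous_const.mul (continuous_inner_prod η)).neg.continuousOn
  · intro s hs ξ
    refine ((hasDerivAt_inv_distSq_pow 2 (distSq_pos η ξ hs).ne').const_mul _).congr_deriv ?_
    push_cast; ring

lemma hasDerivAt_spherePot' {s : ℝ} (hs : s ∈ Set.Ioo (-1 : ℝ) 1) :
    HasDerivAt (spherePot' p η) (spherePot'' p η s) s := by
  refine hasDerivAt_integral_surf isOpen_Ioo
    (G := fun s ξ => polyFun p ξ * (-(4 * (s - ⟪(η : R6), (ξ : R6)⟫)) * (distSq η s ξ ^ 3)⁻¹))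
    (G' := fun s ξ => polyFun p ξ * (24 * (s - ⟪(η : R6), (ξ : R6)⟫) ^ 2 * (distSq η s ξ ^ 4)⁻¹
      - 4 * (distSq η s ξ ^ 3)⁻¹))
    (fun s hs => (continuous_polyFun_S5 p).mul
      (continuous_kernel_deriv η hs)) ?_ ?_ hs
  · refine ((continuous_polyFun_S5 p).comp continuous_snd).continuousOn.mul
      (ContinuousOn.sub (ContinuousOn.mul ?_ (continuousOn_inv_distSq η 4))
        (continuousOn_const.mul (continuousOn_inv_distSq η 3)))
    exact (continuous_const.mul ((continuous_inner_prod η).pow 2)).continuousOn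
  · intro s hs ξ
    have h1 : HasDerivAt (fun s => -(4 * (s - ⟪(η : R6), (ξ : R6)⟫))) (-4) s := by
      simpa using (((hasDerivAt_id s).sub_const ⟪(η : R6), (ξ : R6)⟫).const_mul 4).fun_neg
    refine ((h1.fun_mul (hasDerivAt_inv_distSq_pow 3 (distSq_pos η ξ hs).ne')).const_mul
      _).congr_deriv ?_
    push_cast; ring

/-- The radial Laplace equation: the kernel `|ξ - s η|⁻⁴` is harmonic in `s η`, it depends on `ξ`
and `η` only through `⟨η, ξ⟩`, and the spherical Laplacian in `ξ` can be moved onto the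
eigenfunction `p`. -/
lemma spherePot_ode (hp : p.IsHomogeneous k) (hh : polyLaplacian p = 0) {s : ℝ}
    (hs : s ∈ Set.Ioo (-1 : ℝ) 1) :
    s ^ 2 * spherePot'' p η s + 5 * s * spherePot' p η s
      = (k : ℝ) * (k + 4) * spherePot p η s := by
  set V : Set R6 := {x | 0 < distSq η s x} with hVdef
  have hV : IsOpen V := isOpen_lt continuous_const (by unfold distSq; fun_prop)
  have hS : Metric.sphere 0 1 ⊆ V := fun x hx => distSq_pos η ⟨x, hx⟩ hs
  have hcd : ContDiffOn ℝ 2 (fun x => (distSq η s x ^ 2)⁻¹) V := by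
    refine ContDiffOn.inv (ContDiffOn.pow ?_ 2) fun x hx => pow_ne_zero _ hx.ne'
    unfold distSq
    exact (contDiff_const.sub (contDiff_const.mul (innerSL ℝ (η : R6)).contDiff)).contDiffOn
  have hsym := integral_sphLap_mul hV hS (contDiff_polyFun p).contDiffOn hcd
  have hker : ∀ ξ : S5, sphLap (fun x => (distSq η s x ^ 2)⁻¹) ξ =
      -(s ^ 2 * (24 * (s - ⟪(η : R6), (ξ : R6)⟫) ^ 2 * (distSq η s ξ ^ 4)⁻¹
        - 4 * (distSq η s ξ ^ 3)⁻¹)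
      + 5 * s * (-(4 * (s - ⟪(η : R6), (ξ : R6)⟫)) * (distSq η s ξ ^ 3)⁻¹)) := by
    intro ξ
    have h := sphLap_comp_inner (η := (η : R6)) hV
      (v := fun u => ((1 + s ^ 2 - 2 * s * u) ^ 2)⁻¹)
      (v' := fun u => (2 : ℕ) * (2 * s) * ((1 + s ^ 2 - 2 * s * u) ^ 3)⁻¹)
      (v'' := fun u => (2 : ℕ) * (2 * s) * ((3 : ℕ) * (2 * s) * ((1 + s ^ 2 - 2 * s * u) ^ 4)⁻¹))
      (fun x hx => hasDerivAt_inv_linear_pow 2 (ne_of_gt hx))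
      (fun x hx => (hasDerivAt_inv_linear_pow 3 (ne_of_gt hx)).const_mul _) (hS ξ.2)
    have hpos := (distSq_pos η ξ hs).ne'
    refine h.trans ?_
    rw [norm_S5, norm_S5]
    unfold distSq at hpos ⊢
    set u := ⟪(η : R6), (ξ : R6)⟫
    push_cast
    field_simp
    ring
  have hint : ∀ g : S5 → ℝ, Continuous g → Integrable (fun ξ : S5 => polyFun p ξ * g ξ) surf :=
    fun g hg => integrable_surf ((continuous_polyFun_S5 p).mul hg)
  simp only [sphLap_polyFun hp hh, hker] at hsym
  rw [spherePot'', spherePot', spherePot, ← integral_const_mul, ← integral_const_mul,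
    ← integral_const_mul, ← integral_add
      ((hint _ (continuous_kernel_deriv2 η hs)).const_mul _)
      ((hint _ (continuous_kernel_deriv η hs)).const_mul _)]
  have e1 : ∀ ξ : S5, -((k : ℝ) * (k + 4)) * polyFun p ξ * (distSq η s ξ ^ 2)⁻¹ =
      -((k : ℝ) * (k + 4) * (polyFun p ξ * (distSq η s ξ ^ 2)⁻¹)) := fun ξ => by ring
  simp only [e1, mul_neg, integral_neg] at hsym
  rw [neg_inj] at hsym
  rw [hsym]
  exact integral_congr_ae (.of_forall fun ξ => by simp only; ring)

/-- The regular solutions of the radial Laplace equation are the multiples of `s ^ k`. By the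
equation, `s ^ (k + 4) * (s * u' - k * u)` is constant, and it vanishes at `s = 0`. -/
lemma exists_spherePot_eq (hp : p.IsHomogeneous k) (hh : polyLaplacian p = 0) :
    ∃ a : ℝ, ∀ s ∈ Set.Ioo (0 : ℝ) 1, spherePot p η s = a * s ^ k ∧
      s * spherePot' p η s = k * spherePot p η s := by
  have hm : ∀ s ∈ Set.Ioo (-1 : ℝ) 1, HasDerivAt
      (fun s => s ^ (k + 4) * (s * spherePot' p η s - k * spherePot p η s)) 0 s := by
    intro s hs
    have h0 := hasDerivAt_spherePot (p := p) η hs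
    have h1 := hasDerivAt_spherePot' (p := p) η hs
    refine ((hasDerivAt_pow (k + 4) s).fun_mul
      (((hasDerivAt_id' s).fun_mul h1).fun_sub (h0.const_mul (k : ℝ)))).congr_deriv ?_
    have hode := spherePot_ode η hp hh hs
    simp only [show k + 4 - 1 = k + 3 by omega]
    push_cast
    linear_combination s ^ (k + 3) * hode
  have hzero : ∀ s ∈ Set.Ioo (0 : ℝ) 1, s * spherePot' p η s = k * spherePot p η s := by
    intro s hs
    have hs' : s ∈ Set.Ioo (-1 : ℝ) 1 := ⟨by linarith [hs.1], hs.2⟩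
    have := isOpen_Ioo.is_const_of_deriv_eq_zero isPreconnected_Ioo
      (fun t ht => (hm t ht).differentiableAt.differentiableWithinAt)
      (fun t ht => (hm t ht).deriv) hs' (by norm_num : (0 : ℝ) ∈ Set.Ioo (-1 : ℝ) 1)
    simp only [zero_mul, ne_eq, Nat.add_eq_zero_iff, OfNat.ofNat_ne_zero, and_false,
      not_false_eq_true, zero_pow, mul_eq_zero, pow_eq_zero_iff] at this
    rcases this with h | h
    · exact absurd h hs.1.ne'
    · linarith
  have hq : ∀ s ∈ Set.Ioo (0 : ℝ) 1, HasDerivAt (fun s => spherePot p η s / s ^ k) 0 s := by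
    intro s hs
    have hs' : s ∈ Set.Ioo (-1 : ℝ) 1 := ⟨by linarith [hs.1], hs.2⟩
    have hs0 : s ≠ 0 := hs.1.ne'
    refine ((hasDerivAt_spherePot (p := p) η hs').fun_div (hasDerivAt_pow k s)
      (pow_ne_zero _ hs0)).congr_deriv ?_
    rcases k with _ | k
    · have := hzero s hs
      simp [hs0] at this
      simp [this]
    · have := hzero s hs
      rw [div_eq_zero_iff]; left
      push_cast at this ⊢
      linear_combination s ^ k * this
  obtain ⟨a, ha⟩ := isOpen_Ioo.exists_is_const_of_deriv_eq_zero isPreconnected_Ioo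
    (fun t ht => (hq t ht).differentiableAt.differentiableWithinAt) (fun t ht => (hq t ht).deriv)
  refine ⟨a, fun s hs => ⟨?_, hzero s hs⟩⟩
  have := ha s hs
  rwa [div_eq_iff (pow_ne_zero _ hs.1.ne')] at this

/-- The derivative of the potential along rays is a Poisson integral. -/
lemma spherePot'_add {s : ℝ} (hs : s ∈ Set.Ioo (-1 : ℝ) 1) :
    s * spherePot' p η s + 2 * spherePot p η s =
      2 * ∫ ξ : S5, (1 - s ^ 2) * (distSq η s ξ ^ 3)⁻¹ * polyFun p ξ ∂surf := by
  have hint : ∀ g : S5 → ℝ, Continuous g → Integrable (fun ξ : S5 => polyFun p ξ * g ξ) surf :=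
    fun g hg => integrable_surf ((continuous_polyFun_S5 p).mul hg)
  rw [spherePot', spherePot, ← integral_const_mul, ← integral_const_mul,
    ← integral_const_mul, ← integral_add
      ((hint _ (continuous_kernel_deriv η hs)).const_mul _)
      ((hint _ (continuous_inv_distSq η hs 2)).const_mul _)]
  refine integral_congr_ae (.of_forall fun ξ => ?_)
  have hpos := (distSq_pos η ξ hs).ne'
  simp only
  field_simp
  unfold distSq
  ring
end

/-! ### The Poisson integral and the Funk–Hecke formula -/

/-- The Poisson kernel of the unit ball has mass `π ^ 3`: this is the case of a constant density. -/
lemma integral_poisson (η : S5) {s : ℝ} (hs : s ∈ Set.Ioo (0 : ℝ) 1) :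
    ∫ ξ : S5, (1 - s ^ 2) * (distSq η s ξ ^ 3)⁻¹ ∂surf = Real.pi ^ 3 := by
  have h1 : ∀ x, polyFun 1 x = 1 := fun x => map_one _
  have hΔ : polyLaplacian 1 = 0 := by simp [polyLaplacian]
  obtain ⟨a, ha⟩ := exists_spherePot_eq η (MvPolynomial.isHomogeneous_one (Fin 6) ℝ) hΔ
  have h0 : (0 : ℝ) ∈ Set.Ioo (-1 : ℝ) 1 := by norm_num
  have hc : Tendsto (spherePot 1 η) (𝓝[>] 0) (𝓝 (spherePot 1 η 0)) :=
    (hasDerivAt_spherePot η h0).continuousAt.tendsto.mono_left nhdsWithin_le_nhds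
  have hc' : Tendsto (spherePot 1 η) (𝓝[>] 0) (𝓝 a) := by
    refine tendsto_const_nhds.congr' ?_
    filter_upwards [Ioo_mem_nhdsGT one_pos] with t ht
    simpa using (ha t ht).1.symm
  have hval : spherePot 1 η 0 = Real.pi ^ 3 := by
    rw [← surf_real_univ]; simp [spherePot, h1, distSq]
  have haeq : a = Real.pi ^ 3 := by rw [← hval]; exact tendsto_nhds_unique hc' hc
  have h := spherePot'_add (p := 1) η (s := s) ⟨by linarith [hs.1], hs.2⟩
  rw [(ha s hs).2, (ha s hs).1, haeq] at h
  simp only [h1, mul_one] at h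
  simpa using h.symm

/-- The Poisson integral of a continuous function attains its boundary values along rays. -/
lemma tendsto_poisson (η : S5) {g : S5 → ℝ} (hg : Continuous g) :
    Tendsto (fun s : ℝ => ∫ ξ : S5, (1 - s ^ 2) * (distSq η s ξ ^ 3)⁻¹ * g ξ ∂surf)
      (𝓝[<] 1) (𝓝 (Real.pi ^ 3 * g η)) := by
  have hIoo : Set.Ioo (1 / 2 : ℝ) 1 ∈ 𝓝[<] (1 : ℝ) := Ioo_mem_nhdsLT (by norm_num)
  have hpi : 0 < Real.pi ^ 3 := by positivity
  have hmem : ∀ {s : ℝ}, s ∈ Set.Ioo (1 / 2 : ℝ) 1 → s ∈ Set.Ioo (-1 : ℝ) 1 := fun hs =>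
    ⟨by linarith [hs.1], hs.2⟩
  have key := tendsto_integral_peak_smul_of_integrable_of_tendsto (μ := surf) (x₀ := η)
    (l := 𝓝[<] (1 : ℝ)) (g := g) (a := g η)
    (φ := fun s ξ => (Real.pi ^ 3)⁻¹ * ((1 - s ^ 2) * (distSq η s ξ ^ 3)⁻¹))
    MeasurableSet.univ univ_mem (measure_ne_top _ _) ?_ ?_ ?_ ?_ (integrable_surf hg)
    hg.continuousAt
  · have := key.const_mul (Real.pi ^ 3)
    refine this.congr fun s => ?_
    rw [← integral_const_mul]
    refine integral_congr_ae (.of_forall fun ξ => ?_)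
    simp only [smul_eq_mul]
    field_simp
  · filter_upwards [hIoo] with s hs ξ
    have := distSq_pos η ξ (hmem hs)
    have h2 : 0 ≤ 1 - s ^ 2 := by nlinarith [hs.1, hs.2]
    positivity
  -- away from `η` the kernel is at most a multiple of `1 - s²`
  · intro u hu hηu
    obtain ⟨δ, hδ, hball⟩ := Metric.isOpen_iff.1 hu η hηu
    rw [Metric.tendstoUniformlyOn_iff]
    intro ε hε
    have hlim : Tendsto (fun s : ℝ => (Real.pi ^ 3)⁻¹ * ((1 - s ^ 2) * ((δ ^ 2 / 2) ^ 3)⁻¹))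
        (𝓝[<] 1) (𝓝 0) := by
      have : Continuous fun s : ℝ =>
        (Real.pi ^ 3)⁻¹ * ((1 - s ^ 2) * ((δ ^ 2 / 2) ^ 3)⁻¹) := by fun_prop
      have h := (this.tendsto 1).mono_left (nhdsWithin_le_nhds (s := Set.Iio 1))
      simpa using h
    filter_upwards [hIoo, hlim.eventually (gt_mem_nhds hε)] with s hs hlt ξ hξ
    have hd : δ ≤ ‖(ξ : R6) - η‖ := by
      by_contra hcon
      push Not at hcon
      exact hξ (hball (by rwa [Metric.mem_ball, Subtype.dist_eq, dist_eq_norm]))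
    have hd2 : δ ^ 2 ≤ 2 - 2 * ⟪(η : R6), (ξ : R6)⟫ := by
      have := norm_sub_sq_real (ξ : R6) η
      rw [norm_S5, norm_S5, real_inner_comm] at this
      nlinarith
    have hD : δ ^ 2 / 2 ≤ distSq η s ξ := by
      unfold distSq
      nlinarith [hs.1, sq_nonneg (1 - s), sq_nonneg δ]
    have h2 : 0 ≤ 1 - s ^ 2 := by nlinarith [hs.1, hs.2]
    have hDpos := distSq_pos η ξ (hmem hs)
    have h3 : 0 ≤ (Real.pi ^ 3)⁻¹ * ((1 - s ^ 2) * (distSq η s ξ ^ 3)⁻¹) := by positivity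
    simp only [Pi.zero_apply, dist_zero_left, Real.norm_eq_abs]
    rw [abs_of_nonneg h3]
    refine lt_of_le_of_lt ?_ hlt
    gcongr
  · refine tendsto_const_nhds.congr' ?_
    filter_upwards [hIoo] with s hs
    rw [Measure.restrict_univ, integral_const_mul, integral_poisson η ⟨by linarith [hs.1], hs.2⟩,
      inv_mul_cancel₀ hpi.ne']
  · filter_upwards [hIoo] with s hs
    exact (continuous_const.mul (continuous_const.mul
      (continuous_inv_distSq η (hmem hs) 3))).aestronglyMeasurable

/-- The Funk–Hecke formula for the Newtonian kernel. For `u = a sᵏ` the left-hand side of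
`spherePot'_add` is `(k + 2) u`; letting `s → 1` on both sides determines `a`. -/
lemma spherePot_eq {p : MvPolynomial (Fin 6) ℝ} {k : ℕ} (hp : p.IsHomogeneous k)
    (hh : polyLaplacian p = 0) (η : S5) {s : ℝ} (hs : s ∈ Set.Ioo (0 : ℝ) 1) :
    spherePot p η s = 2 * Real.pi ^ 3 / (k + 2) * s ^ k * polyFun p η := by
  obtain ⟨a, ha⟩ := exists_spherePot_eq η hp hh
  have h1 := (tendsto_poisson η (continuous_polyFun_S5 p)).const_mul 2
  have h2 : Tendsto (fun s : ℝ => (k + 2) * (a * s ^ k)) (𝓝[<] 1) (𝓝 ((k + 2) * (a * 1 ^ k))) := by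
    have : Continuous fun s : ℝ => ((k : ℝ) + 2) * (a * s ^ k) := by fun_prop
    exact (this.tendsto 1).mono_left nhdsWithin_le_nhds
  have h3 := tendsto_nhds_unique (h2.congr' ?_) h1
  · rw [(ha s hs).1]
    rw [one_pow, mul_one] at h3
    have : a = 2 * Real.pi ^ 3 / (k + 2) * polyFun p η := by
      field_simp; linarith
    rw [this]; ring
  · filter_upwards [Ioo_mem_nhdsLT (zero_lt_one : (0 : ℝ) < 1)] with t ht
    rw [← spherePot'_add η ⟨by linarith [ht.1], ht.2⟩, (ha t ht).2, (ha t ht).1]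
    ring

lemma norm_smul_sub_smul_pow (r t : ℝ) (ξ η : S5) :
    ‖r • (ξ : R6) - t • (η : R6)‖ ^ 4 = (r ^ 2 + t ^ 2 - 2 * r * t * ⟪(η : R6), (ξ : R6)⟫) ^ 2 := by
  have h : ‖r • (ξ : R6) - t • (η : R6)‖ ^ 2 =
      r ^ 2 + t ^ 2 - 2 * r * t * ⟪(η : R6), (ξ : R6)⟫ := by
    rw [norm_sub_sq_real, norm_smul, norm_smul, norm_S5, norm_S5, real_inner_smul_left,
      real_inner_smul_right, real_inner_comm]
    simp only [mul_one, Real.norm_eq_abs, sq_abs]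
    ring
  rw [← h]; ring

lemma pow_mul_distSq {M m : ℝ} (hM : 0 < M) (η : R6) (x : R6) :
    M ^ 4 * distSq η (m / M) x ^ 2 = (M ^ 2 + m ^ 2 - 2 * M * m * ⟪η, x⟫) ^ 2 := by
  unfold distSq; field_simp

/-- Integrating the Newtonian kernel against a spherical harmonic of degree `k` over a sphere yields
the radial kernel `K_k`. -/
lemma integral_kernel {Y : S5 → ℝ} {k : ℕ} (hY : Y ∈ sphericalHarmonics k) {r t : ℝ} (hr : 0 < r)
    (ht : 0 < t) (hrt : r ≠ t) (η : S5) :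
    ∫ ξ : S5, Y ξ / ‖r • (ξ : R6) - t • (η : R6)‖ ^ 4 ∂surf = kernelK k t r / t ^ 5 * Y η := by
  obtain ⟨p, ⟨hp, hh⟩, rfl⟩ := hY
  have hp' : p.IsHomogeneous k := hp
  have hh' : polyLaplacian p = 0 := hh
  simp only [restrictSphere_apply, norm_smul_sub_smul_pow]
  -- `m` and `M` are the smaller and the larger one of the two radii
  have main : ∀ {m M : ℝ}, 0 < m → m < M →
      (∀ ξ : S5, (r ^ 2 + t ^ 2 - 2 * r * t * ⟪(η : R6), (ξ : R6)⟫) ^ 2 =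
        M ^ 4 * distSq η (m / M) ξ ^ 2) →
      ∫ ξ : S5, polyFun p ξ / (r ^ 2 + t ^ 2 - 2 * r * t * ⟪(η : R6), (ξ : R6)⟫) ^ 2 ∂surf =
        2 * Real.pi ^ 3 / (k + 2) * (m / M) ^ k / M ^ 4 * polyFun p η := by
    intro m M hm hmM h
    have hM : 0 < M := hm.trans hmM
    have hs : m / M ∈ Set.Ioo (0 : ℝ) 1 := ⟨by positivity, (div_lt_one hM).2 hmM⟩
    have e : ∀ ξ : S5, polyFun p ξ / (r ^ 2 + t ^ 2 - 2 * r * t * ⟪(η : R6), (ξ : R6)⟫) ^ 2 =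
        (M ^ 4)⁻¹ * (polyFun p ξ * (distSq η (m / M) ξ ^ 2)⁻¹) := by
      intro ξ
      rw [h ξ, div_eq_mul_inv, mul_inv]; ring
    simp only [e]
    rw [integral_const_mul]
    change (M ^ 4)⁻¹ * spherePot p η (m / M) = _
    rw [spherePot_eq hp' hh' η hs]
    ring
  rcases lt_or_gt_of_ne hrt with h | h
  · rw [main hr h fun ξ => by rw [pow_mul_distSq ht]; ring, kernelK, if_neg h.not_gt]
    rw [zpow_sub₀ ht.ne', zpow_natCast, zpow_one, div_pow]
    field_simp
  · rw [main ht h fun ξ => by rw [pow_mul_distSq hr], kernelK, if_pos h, div_pow]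
    field_simp
    ring

/-! ### Completeness of the spherical harmonics -/

/-- The polynomial `|x|²`. -/
def normSqPoly : MvPolynomial (Fin 6) ℝ := ∑ i, MvPolynomial.X i ^ 2

lemma isHomogeneous_normSqPoly : normSqPoly.IsHomogeneous 2 :=
  MvPolynomial.IsHomogeneous.sum _ _ _ fun i _ => MvPolynomial.isHomogeneous_X_pow i 2

lemma polyFun_normSqPoly (ξ : S5) : polyFun normSqPoly ξ = 1 := by
  have h : ‖(ξ : R6)‖ ^ 2 = ∑ i, (ξ : R6) i ^ 2 := by
    rw [EuclideanSpace.norm_sq_eq]; simp only [Real.norm_eq_abs, sq_abs]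
  have h2 : polyFun normSqPoly ξ = ∑ i, (ξ : R6) i ^ 2 := by
    rw [normSqPoly, polyFun_sum]; simp [polyFun]
  rw [h2, ← h, norm_S5, one_pow]

lemma polyLaplacian_apply (p : MvPolynomial (Fin 6) ℝ) :
    polyLaplacian p = ∑ i, MvPolynomial.pderiv i (MvPolynomial.pderiv i p) := by
  simp [polyLaplacian, LinearMap.sum_apply]

lemma pderiv_normSqPoly (i : Fin 6) :
    MvPolynomial.pderiv i normSqPoly = 2 * MvPolynomial.X i := by
  rw [normSqPoly, map_sum, Finset.sum_eq_single i]
  · rw [pow_two, Derivation.leibniz]; simp; ring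
  · intro j _ hj
    rw [pow_two, Derivation.leibniz]; simp [MvPolynomial.pderiv_X_of_ne hj]
  · simp

lemma polyLaplacian_normSqPoly_mul {p : MvPolynomial (Fin 6) ℝ} {m : ℕ} (hp : p.IsHomogeneous m) :
    polyLaplacian (normSqPoly * p) =
      normSqPoly * polyLaplacian p + (12 + 4 * (m : ℝ)) • p := by
  have h : ∀ i, MvPolynomial.pderiv i (MvPolynomial.pderiv i (normSqPoly * p)) =
      2 * p + 4 * (MvPolynomial.X i * MvPolynomial.pderiv i p)
        + normSqPoly * MvPolynomial.pderiv i (MvPolynomial.pderiv i p) := by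
    intro i
    have h2 : MvPolynomial.pderiv i (2 : MvPolynomial (Fin 6) ℝ) = 0 := by
      rw [← map_ofNat MvPolynomial.C 2, MvPolynomial.pderiv_C]
    simp only [Derivation.leibniz, map_add, pderiv_normSqPoly, smul_eq_mul, h2,
      MvPolynomial.pderiv_X_self]
    ring
  rw [polyLaplacian_apply, polyLaplacian_apply, Finset.sum_congr rfl fun i _ => h i,
    Finset.sum_add_distrib, Finset.sum_add_distrib, ← Finset.mul_sum, ← Finset.mul_sum,
    hp.sum_X_mul_pderiv, add_smul, mul_smul]
  have e1 : (12 : ℝ) • p = 12 * p := by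
    rw [MvPolynomial.smul_eq_C_mul, map_ofNat]
  have e2 : (4 : ℝ) • (m : ℝ) • p = 4 * (m • p) := by
    rw [MvPolynomial.smul_eq_C_mul, map_ofNat, Nat.cast_smul_eq_nsmul]
  rw [e1, e2]
  simp only [← Finset.mul_sum, Finset.sum_const, Finset.card_univ, Fintype.card_fin, nsmul_eq_mul]
  push_cast
  ring

lemma polyLaplacian_isHomogeneous {p : MvPolynomial (Fin 6) ℝ} {m : ℕ}
    (hp : p.IsHomogeneous (m + 2)) : (polyLaplacian p).IsHomogeneous m := by
  rw [polyLaplacian_apply]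
  exact MvPolynomial.IsHomogeneous.sum _ _ _ fun i _ => by simpa using hp.pderiv.pderiv

lemma polyLaplacian_eq_zero {p : MvPolynomial (Fin 6) ℝ} {m : ℕ} (hm : m < 2)
    (hp : p.IsHomogeneous m) : polyLaplacian p = 0 := by
  rw [polyLaplacian_apply]
  refine Finset.sum_eq_zero fun i _ => ?_
  have h := hp.pderiv (i := i)
  rw [show m - 1 = 0 by omega, ← MvPolynomial.totalDegree_zero_iff_isHomogeneous,
    MvPolynomial.totalDegree_eq_zero_iff_eq_C] at h
  rw [h, MvPolynomial.pderiv_C]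

/-- The operator `q ↦ Δ(|x|² q) + c q` is onto on homogeneous polynomials of every degree. Only
`c = 0` is needed to split off a harmonic polynomial, but the induction, which lowers the degree by
two, uses the statement for other `c`. -/
lemma exists_polyLaplacian_eq (m : ℕ) : ∀ c : ℝ, 0 ≤ c → ∀ p : MvPolynomial (Fin 6) ℝ,
    p.IsHomogeneous m → ∃ q : MvPolynomial (Fin 6) ℝ, q.IsHomogeneous m ∧
      polyLaplacian (normSqPoly * q) + c • q = p := by
  have base : ∀ m < 2, ∀ c : ℝ, 0 ≤ c → ∀ p : MvPolynomial (Fin 6) ℝ,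
      p.IsHomogeneous m → ∃ q : MvPolynomial (Fin 6) ℝ, q.IsHomogeneous m ∧
        polyLaplacian (normSqPoly * q) + c • q = p := by
    intro m hm c hc p hp
    have hd : (12 + 4 * (m : ℝ) + c) ≠ 0 := by positivity
    have hq : ((12 + 4 * (m : ℝ) + c)⁻¹ • p).IsHomogeneous m :=
      (MvPolynomial.homogeneousSubmodule (Fin 6) ℝ m).smul_mem _ hp
    refine ⟨_, hq, ?_⟩
    rw [polyLaplacian_normSqPoly_mul hq, polyLaplacian_eq_zero hm hq, mul_zero, zero_add,
      ← add_smul, smul_smul, mul_inv_cancel₀ hd, one_smul]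
  induction m using Nat.twoStepInduction with
  | zero => exact base 0 (by norm_num)
  | one => exact base 1 (by norm_num)
  | more m IH _ =>
    intro c hc p hp
    obtain ⟨q', hq', hΔ⟩ := IH 0 le_rfl _ (polyLaplacian_isHomogeneous hp)
    rw [zero_smul, add_zero] at hΔ
    have hQq' : (normSqPoly * q').IsHomogeneous (m + 2) := by
      simpa [add_comm] using isHomogeneous_normSqPoly.mul hq'
    set d : ℝ := 12 + 4 * ((m + 2 : ℕ) : ℝ) + c with hd
    have hdpos : 0 < d := by positivity
    obtain ⟨y, hy, hyeq⟩ := IH d hdpos.le q' hq'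
    have hQy : (normSqPoly * y).IsHomogeneous (m + 2) := by
      simpa [add_comm] using isHomogeneous_normSqPoly.mul hy
    have hh : (d⁻¹ • (p - normSqPoly * q')).IsHomogeneous (m + 2) :=
      (MvPolynomial.homogeneousSubmodule (Fin 6) ℝ (m + 2)).smul_mem _ (hp.sub hQq')
    -- `p - |x|² q'` is harmonic, so the operator acts on it as the scalar `d`; on the multiples of
    -- `|x|²` it acts as `|x|² y ↦ |x|² (Δ(|x|² y) + d y)`
    refine ⟨d⁻¹ • (p - normSqPoly * q') + normSqPoly * y, hh.add hQy, ?_⟩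
    have hharm : polyLaplacian (d⁻¹ • (p - normSqPoly * q')) = 0 := by
      rw [map_smul, map_sub, hΔ, sub_self, smul_zero]
    rw [mul_add, map_add, polyLaplacian_normSqPoly_mul hh, polyLaplacian_normSqPoly_mul hQy, hharm]
    have e : q' = polyLaplacian (normSqPoly * y) + d • y := hyeq.symm
    have e3 : p = d • d⁻¹ • (p - normSqPoly * q') + normSqPoly * q' := by
      rw [smul_smul, mul_inv_cancel₀ hdpos.ne', one_smul]; ring
    conv_rhs => rw [e3]
    generalize d⁻¹ • (p - normSqPoly * q') = h
    rw [e, hd]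
    simp only [MvPolynomial.smul_eq_C_mul, map_add]
    ring

/-- The restriction to the sphere of a homogeneous polynomial is a sum of spherical harmonics. -/
lemma restrictSphere_mem_of_isHomogeneous (m : ℕ) : ∀ p : MvPolynomial (Fin 6) ℝ,
    p.IsHomogeneous m → restrictSphere p ∈ ⨆ k, sphericalHarmonics k := by
  have base : ∀ m, ∀ p : MvPolynomial (Fin 6) ℝ, p.IsHomogeneous m → polyLaplacian p = 0 →
      restrictSphere p ∈ ⨆ k, sphericalHarmonics k := fun m p hp hΔ =>
    Submodule.mem_iSup_of_mem m ⟨p, ⟨hp, hΔ⟩, rfl⟩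
  induction m using Nat.twoStepInduction with
  | zero => exact fun p hp => base 0 p hp (polyLaplacian_eq_zero (by norm_num) hp)
  | one => exact fun p hp => base 1 p hp (polyLaplacian_eq_zero (by norm_num) hp)
  | more m IH _ =>
    intro p hp
    obtain ⟨q, hq, hΔ⟩ := exists_polyLaplacian_eq m 0 le_rfl _ (polyLaplacian_isHomogeneous hp)
    rw [zero_smul, add_zero] at hΔ
    have hQq : (normSqPoly * q).IsHomogeneous (m + 2) := by
      simpa [add_comm] using isHomogeneous_normSqPoly.mul hq
    have h1 := base (m + 2) (p - normSqPoly * q) (hp.sub hQq) (by rw [map_sub, hΔ, sub_self])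
    have h2 : restrictSphere p = restrictSphere (p - normSqPoly * q) + restrictSphere q := by
      funext ξ
      have : polyFun p ξ = polyFun (p - normSqPoly * q + normSqPoly * q) ξ := by
        rw [sub_add_cancel]
      simp only [Pi.add_apply, restrictSphere_apply]
      rw [this, polyFun_add, polyFun_mul normSqPoly q, polyFun_normSqPoly, one_mul]
    rw [h2]
    exact add_mem h1 (IH q hq)

lemma restrictSphere_mem (p : MvPolynomial (Fin 6) ℝ) :
    restrictSphere p ∈ ⨆ k, sphericalHarmonics k := by
  rw [← MvPolynomial.sum_homogeneousComponent p, map_sum]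
  exact Submodule.sum_mem _ fun i _ => restrictSphere_mem_of_isHomogeneous i _
    (MvPolynomial.homogeneousComponent_isHomogeneous i p)

/-- Spherical harmonics of different degrees are orthogonal, having different eigenvalues. -/
lemma integral_mul_sphericalHarmonics {k l : ℕ} (hkl : k ≠ l) {Y Z : S5 → ℝ}
    (hY : Y ∈ sphericalHarmonics k) (hZ : Z ∈ sphericalHarmonics l) :
    ∫ ξ, Y ξ * Z ξ ∂surf = 0 := by
  obtain ⟨p, ⟨hp, hpΔ⟩, rfl⟩ := hY
  obtain ⟨q, ⟨hq, hqΔ⟩, rfl⟩ := hZ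
  have h := integral_sphLap_mul isOpen_univ (Set.subset_univ _) (contDiff_polyFun p).contDiffOn
    (contDiff_polyFun q).contDiffOn
  simp only [sphLap_polyFun hp hpΔ, sphLap_polyFun hq hqΔ] at h
  have e1 : ∀ ξ : S5, -((k : ℝ) * (k + 4)) * polyFun p ξ * polyFun q ξ =
    -((k : ℝ) * (k + 4)) * (polyFun p ξ * polyFun q ξ) := fun ξ => by ring
  have e2 : ∀ ξ : S5, polyFun p ξ * (-((l : ℝ) * (l + 4)) * polyFun q ξ) =
    -((l : ℝ) * (l + 4)) * (polyFun p ξ * polyFun q ξ) := fun ξ => by ring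
  simp only [e1, e2, integral_const_mul] at h
  simp only [restrictSphere_apply]
  have h3 : ((k : ℝ) - l) * ((k + l + 4) * ∫ ξ : S5, polyFun p ξ * polyFun q ξ ∂surf) = 0 := by
    linear_combination -h
  have h4 : (k : ℝ) - l ≠ 0 := sub_ne_zero.2 (by exact_mod_cast hkl)
  have h5 : (k : ℝ) + l + 4 ≠ 0 := by positivity
  simpa [h4, h5] using h3

lemma continuous_of_mem_sphericalHarmonics {k : ℕ} {Y : S5 → ℝ}
    (hY : Y ∈ sphericalHarmonics k) : Continuous Y := by
  obtain ⟨p, -, rfl⟩ := hY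
  exact continuous_polyFun_S5 p

lemma memLp_surf {F : S5 → ℝ} (hF : Continuous F) (p : ℝ≥0∞) : MemLp F p surf := by
  have := (hF.memLp_top_of_hasCompactSupport (HasCompactSupport.of_compactSpace F) surf)
  exact this.mono_exponent le_top

/-- A polynomial as a continuous function on the sphere. -/
def polySphere : MvPolynomial (Fin 6) ℝ →ₐ[ℝ] C(S5, ℝ) :=
  MvPolynomial.aeval fun i => ⟨fun ξ => (ξ : R6) i, by fun_prop⟩

lemma polySphere_apply (p : MvPolynomial (Fin 6) ℝ) (ξ : S5) : polySphere p ξ = polyFun p ξ := by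
  have h : ((ContinuousMap.evalAlgHom ℝ ℝ ξ).comp polySphere) =
      MvPolynomial.aeval fun i => (ξ : R6) i := by
    apply MvPolynomial.algHom_ext
    intro i
    simp [polySphere]
  exact congrArg (fun f => f p) h

lemma polySphere_dense : polySphere.range.topologicalClosure = ⊤ := by
  apply ContinuousMap.subalgebra_topologicalClosure_eq_top_of_separatesPoints
  intro ξ η hne
  obtain ⟨i, hi⟩ : ∃ i, (ξ : R6) i ≠ (η : R6) i := by
    by_contra hcon
    push Not at hcon
    exact hne (Subtype.ext (PiLp.ext hcon))
  refine ⟨_, ⟨polySphere (MvPolynomial.X i), ⟨_, rfl⟩, rfl⟩, ?_⟩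
  simpa [polySphere_apply, polyFun_X] using hi

section
variable {Y : (k : ℕ) → Fin (alpha k) → S5 → ℝ}

lemma IsSphericalBasis.mem (hY : IsSphericalBasis Y) (k : ℕ) (j : Fin (alpha k)) :
    Y k j ∈ sphericalHarmonics k := by
  rw [← hY.span_eq]; exact Submodule.subset_span ⟨j, rfl⟩

lemma IsSphericalBasis.continuous (hY : IsSphericalBasis Y) (k : ℕ) (j : Fin (alpha k)) :
    Continuous (Y k j) := continuous_of_mem_sphericalHarmonics (hY.mem k j)

/-- The normalized spherical harmonics as vectors of `L²`. -/
def sphVec (hY : IsSphericalBasis Y) (i : Σ k, Fin (alpha k)) : Lp ℝ 2 surf :=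
  (Real.sqrt (Real.pi ^ 3))⁻¹ • (memLp_surf (hY.continuous i.1 i.2) 2).toLp

lemma inner_toLp {u v : S5 → ℝ} (hu : MemLp u 2 surf) (hv : MemLp v 2 surf) :
    ⟪hu.toLp, hv.toLp⟫ = ∫ ξ, u ξ * v ξ ∂surf := by
  rw [L2.inner_def]
  refine integral_congr_ae ?_
  filter_upwards [hu.coeFn_toLp, hv.coeFn_toLp] with ξ h1 h2
  rw [h1, h2]; simp [mul_comm]

lemma orthonormal_sphVec (hY : IsSphericalBasis Y) : Orthonormal ℝ (sphVec hY) := by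
  classical
  rw [orthonormal_iff_ite]
  rintro ⟨k, i⟩ ⟨l, j⟩
  have hpi : 0 < Real.pi ^ 3 := by positivity
  rw [sphVec, sphVec, real_inner_smul_left, real_inner_smul_right, inner_toLp]
  rcases eq_or_ne k l with rfl | hkl
  · simp only
    rw [hY.orthogonal]
    by_cases hij : i = j
    · subst hij
      simp only [if_true]
      have := Real.mul_self_sqrt hpi.le
      field_simp
      linarith
    · simp [hij]
  · simp only
    rw [integral_mul_sphericalHarmonics hkl (hY.mem k i) (hY.mem l j)]
    simp [hkl]

/-- The spherical harmonics are total in `L²`: polynomials are dense in the continuous functions,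
and on the sphere every polynomial is a sum of spherical harmonics. -/
lemma dense_sphVec (hY : IsSphericalBasis Y) :
    ⊤ ≤ (Submodule.span ℝ (Set.range (sphVec hY))).topologicalClosure := by
  set K := (Submodule.span ℝ (Set.range (sphVec hY))).topologicalClosure with hK
  have hKc : IsClosed (K : Set (Lp ℝ 2 surf)) := Submodule.isClosed_topologicalClosure _
  let T : C(S5, ℝ) →L[ℝ] Lp ℝ 2 surf := ContinuousMap.toLp 2 surf ℝ
  have hT : ∀ G : C(S5, ℝ), T G = (memLp_surf G.continuous 2).toLp := fun G => rfl
  let N : Submodule ℝ (S5 → ℝ) := (K.comap T.toLinearMap).map (ContinuousMap.coeFnLinearMap ℝ)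
  have hpi : 0 < Real.sqrt (Real.pi ^ 3) := by positivity
  have hN : ∀ k, sphericalHarmonics k ≤ N := by
    intro k
    rw [← hY.span_eq, Submodule.span_le]
    rintro _ ⟨j, rfl⟩
    refine ⟨⟨Y k j, hY.continuous k j⟩, ?_, rfl⟩
    change T _ ∈ K
    have : T ⟨Y k j, hY.continuous k j⟩ = Real.sqrt (Real.pi ^ 3) • sphVec hY ⟨k, j⟩ := by
      rw [hT, sphVec, smul_smul, mul_inv_cancel₀ hpi.ne', one_smul]; rfl
    rw [this]
    exact K.smul_mem _ (Submodule.le_topologicalClosure _ (Submodule.subset_span ⟨_, rfl⟩))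
  have hpoly : ∀ p, T (polySphere p) ∈ K := by
    intro p
    obtain ⟨G, hG, hGe⟩ := (iSup_le hN) (restrictSphere_mem p)
    have : G = polySphere p := by
      ext ξ
      rw [polySphere_apply, ← restrictSphere_apply, ← hGe]; rfl
    rw [← this]; exact hG
  have hall : ∀ G : C(S5, ℝ), T G ∈ K := by
    intro G
    have hcl : IsClosed (T ⁻¹' (K : Set (Lp ℝ 2 surf))) := hKc.preimage T.continuous
    have hG : G ∈ polySphere.range.topologicalClosure := by rw [polySphere_dense]; trivial
    have hG' : G ∈ closure (polySphere.range : Set C(S5, ℝ)) := hG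
    refine closure_minimal ?_ hcl hG'
    rintro _ ⟨p, rfl⟩
    exact hpoly p
  have hdense : DenseRange T := ContinuousMap.toLp_denseRange ℝ surf ℝ (by norm_num)
  intro x _
  have hx := hdense x
  refine closure_minimal ?_ hKc hx
  rintro _ ⟨G, rfl⟩
  exact hall G

/-- The Hilbert basis of `L²` of the sphere given by the normalized spherical harmonics. -/
def sphBasis (hY : IsSphericalBasis Y) : HilbertBasis (Σ k, Fin (alpha k)) ℝ (Lp ℝ 2 surf) :=
  HilbertBasis.mk (orthonormal_sphVec hY) (dense_sphVec hY)

lemma sphBasis_apply (hY : IsSphericalBasis Y) (i : Σ k, Fin (alpha k)) :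
    sphBasis hY i = sphVec hY i := by
  rw [sphBasis, HilbertBasis.coe_mk]

lemma inner_sphBasis (hY : IsSphericalBasis Y) {u : S5 → ℝ} (hu : MemLp u 2 surf)
    (i : Σ k, Fin (alpha k)) : ⟪sphBasis hY i, hu.toLp⟫ =
      (Real.sqrt (Real.pi ^ 3))⁻¹ * ∫ ξ, u ξ * Y i.1 i.2 ξ ∂surf := by
  rw [sphBasis_apply, sphVec, real_inner_smul_left, inner_toLp]
  simp only [mul_comm]

/-- Parseval's identity on the sphere. -/
lemma hasSum_integral_mul (hY : IsSphericalBasis Y) {u v : S5 → ℝ} (hu : MemLp u 2 surf)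
    (hv : MemLp v 2 surf) :
    HasSum (fun k => ∑ j, 1 / Real.pi ^ 3 * ((∫ ξ, u ξ * Y k j ξ ∂surf) *
      ∫ ξ, v ξ * Y k j ξ ∂surf)) (∫ ξ, u ξ * v ξ ∂surf) := by
  have h := (sphBasis hY).hasSum_inner_mul_inner hu.toLp hv.toLp
  rw [inner_toLp] at h
  have h2 := h.sigma fun k => hasSum_fintype
    (fun j => ⟪hu.toLp, sphBasis hY ⟨k, j⟩⟫ * ⟪sphBasis hY ⟨k, j⟩, hv.toLp⟫)
  have e : ∀ k, (∑ j, ⟪hu.toLp, sphBasis hY ⟨k, j⟩⟫ * ⟪sphBasis hY ⟨k, j⟩, hv.toLp⟫) =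
      ∑ j, 1 / Real.pi ^ 3 * ((∫ ξ, u ξ * Y k j ξ ∂surf) * ∫ ξ, v ξ * Y k j ξ ∂surf) := by
    intro k
    refine Finset.sum_congr rfl fun j _ => ?_
    rw [real_inner_comm, inner_sphBasis hY hu, inner_sphBasis hY hv]
    have hs : Real.sqrt (Real.pi ^ 3) * Real.sqrt (Real.pi ^ 3) = Real.pi ^ 3 :=
      Real.mul_self_sqrt (by positivity)
    have hs' : (Real.sqrt (Real.pi ^ 3))⁻¹ * (Real.sqrt (Real.pi ^ 3))⁻¹ = 1 / Real.pi ^ 3 := by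
      rw [← mul_inv, hs, one_div]
    rw [← hs']
    ring
  simpa only [e] using h2

/-- Expansion in spherical harmonics, converging in `L²` of the sphere. -/
lemma tendsto_eLpNorm_sub_sum (hY : IsSphericalBasis Y) {u : S5 → ℝ} (hu : MemLp u 2 surf) :
    Tendsto (fun N : ℕ => eLpNorm (fun ξ => u ξ - ∑ k ∈ Finset.range N, ∑ j,
      (1 / Real.pi ^ 3 * ∫ ξ, u ξ * Y k j ξ ∂surf) * Y k j ξ) 2 surf) atTop (𝓝 0) := by
  have h := (sphBasis hY).hasSum_repr hu.toLp
  have h2 := (h.sigma fun k => hasSum_fintype _).tendsto_sum_nat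
  rw [Lp.tendsto_Lp_iff_tendsto_eLpNorm] at h2
  refine h2.congr fun N => ?_
  set c : (k : ℕ) → Fin (alpha k) → ℝ := fun k j => 1 / Real.pi ^ 3 * ∫ ξ, u ξ * Y k j ξ ∂surf
  let T : C(S5, ℝ) →L[ℝ] Lp ℝ 2 surf := ContinuousMap.toLp 2 surf ℝ
  let G : C(S5, ℝ) := ∑ k ∈ Finset.range N, ∑ j, c k j • ⟨Y k j, hY.continuous k j⟩
  have hs : Real.sqrt (Real.pi ^ 3) * Real.sqrt (Real.pi ^ 3) = Real.pi ^ 3 :=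
    Real.mul_self_sqrt (by positivity)
  have hpi : 0 < Real.sqrt (Real.pi ^ 3) := by positivity
  have hsum : ∑ k ∈ Finset.range N, ∑ j, (sphBasis hY).repr hu.toLp ⟨k, j⟩ • sphBasis hY ⟨k, j⟩ =
      T G := by
    simp only [G, map_sum, map_smul]
    refine Finset.sum_congr rfl fun k _ => Finset.sum_congr rfl fun j _ => ?_
    rw [HilbertBasis.repr_apply_apply, inner_sphBasis, sphBasis_apply, sphVec, smul_smul]
    change _ = c k j • (memLp_surf (hY.continuous k j) 2).toLp
    congr 1
    simp only [c]
    have hs' : (Real.sqrt (Real.pi ^ 3))⁻¹ * (Real.sqrt (Real.pi ^ 3))⁻¹ = 1 / Real.pi ^ 3 := by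
      rw [← mul_inv, hs, one_div]
    rw [← hs']
    ring
  rw [hsum, eLpNorm_sub_comm]
  refine eLpNorm_congr_ae ?_
  filter_upwards [ContinuousMap.coeFn_toLp (p := 2) (𝕜 := ℝ) surf G] with ξ hξ
  rw [Pi.sub_apply, hξ]
  simp [G, c, ContinuousMap.sum_apply]
end

/-! ### Polar coordinates and Parseval's identity -/

instance : SFinite radialMeasure := by unfold radialMeasure; infer_instance

lemma map_subtype_volumeIoiPow :
    Measure.map Subtype.val (Measure.volumeIoiPow 5) = radialMeasure := by
  rw [Measure.volumeIoiPow, radialMeasure]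
  have hemb : MeasurableEmbedding (Subtype.val : Set.Ioi (0 : ℝ) → ℝ) :=
    MeasurableEmbedding.subtype_coe measurableSet_Ioi
  have hmeas : Measurable fun r : ℝ => ENNReal.ofReal (r ^ 5) := by fun_prop
  ext s hs
  rw [Measure.map_apply measurable_subtype_coe hs,
    withDensity_apply _ (measurable_subtype_coe hs), withDensity_apply _ hs,
    setLIntegral_subtype measurableSet_Ioi _ fun r : ℝ => ENNReal.ofReal (r ^ 5),
    Measure.restrict_restrict hs, Subtype.image_preimage_coe, Set.inter_comm]

/-- Polar coordinates. The measure `radialMeasure` lives on `(0, ∞)`, so that the map is not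
affected by its values at radii `r ≤ 0`. -/
lemma measurePreserving_polar :
    MeasurePreserving (fun q : ℝ × S5 => q.1 • (q.2 : R6)) (radialMeasure.prod surf) volume := by
  have hm : Measurable fun q : ℝ × S5 => q.1 • (q.2 : R6) :=
    (by fun_prop : Continuous fun q : ℝ × S5 => q.1 • (q.2 : R6)).measurable
  have h1 := ((volume : Measure R6).measurePreserving_homeomorphUnitSphereProd).symm
    (homeomorphUnitSphereProd R6).toMeasurableEquiv
  have h2 : MeasurePreserving (Subtype.val : ({0}ᶜ : Set R6) → R6)
      ((volume : Measure R6).comap (↑)) volume := by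
    refine ⟨measurable_subtype_coe, ?_⟩
    rw [(MeasurableEmbedding.subtype_coe (measurableSet_singleton (0 : R6)).compl).map_comap]
    rw [Subtype.range_coe, restrict_compl_singleton]
  have h3 := h2.comp h1
  have hdim : Module.finrank ℝ R6 - 1 = 5 := by simp
  rw [hdim] at h3
  refine ⟨hm, ?_⟩
  have h4 : radialMeasure.prod surf = Measure.map (fun q : S5 × Set.Ioi (0 : ℝ) => ((q.2 : ℝ), q.1))
      (surf.prod (Measure.volumeIoiPow 5)) := by
    rw [← map_subtype_volumeIoiPow, ← Measure.map_id (μ := surf),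
      Measure.map_prod_map _ _ measurable_subtype_coe measurable_id, Measure.map_id,
      ← Measure.prod_swap, Measure.map_map (by fun_prop) (by fun_prop)]
    rfl
  rw [h4, Measure.map_map hm (by fun_prop)]
  exact h3.map_eq

lemma ae_radialMeasure {p : ℝ → Prop} :
    (∀ᵐ r ∂radialMeasure, p r) ↔ ∀ᵐ r ∂(volume.restrict (Set.Ioi (0 : ℝ))), p r := by
  rw [radialMeasure, ae_withDensity_iff (by fun_prop)]
  refine ⟨fun h => ?_, fun h => ?_⟩
  · filter_upwards [h, ae_restrict_mem measurableSet_Ioi] with r hr hr0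
    refine hr ?_
    have : (0 : ℝ) < r ^ 5 := pow_pos hr0 5
    simpa using this
  · filter_upwards [h] with r hr _ using hr

lemma integrable_radialMeasure {g : ℝ → ℝ} :
    Integrable g radialMeasure ↔ IntegrableOn (fun r => r ^ 5 * g r) (Set.Ioi 0) := by
  rw [radialMeasure, integrable_withDensity_iff_integrable_smul' (by fun_prop) (by simp),
    IntegrableOn]
  refine integrable_congr ?_
  filter_upwards [ae_restrict_mem measurableSet_Ioi] with r hr
  rw [ENNReal.toReal_ofReal (pow_nonneg (le_of_lt hr) 5), smul_eq_mul]

lemma integral_radialMeasure (g : ℝ → ℝ) :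
    ∫ r, g r ∂radialMeasure = ∫ r in Set.Ioi 0, r ^ 5 * g r := by
  rw [radialMeasure, integral_withDensity_eq_integral_toReal_smul (by fun_prop) (by simp)]
  refine setIntegral_congr_fun measurableSet_Ioi fun r hr => ?_
  rw [ENNReal.toReal_ofReal (pow_nonneg (le_of_lt hr) 5), smul_eq_mul]

lemma integrable_polar {F : R6 → ℝ} (hF : Integrable F) :
    Integrable (fun q : ℝ × S5 => F (q.1 • (q.2 : R6))) (radialMeasure.prod surf) :=
  (measurePreserving_polar.integrable_comp hF.aestronglyMeasurable).2 hF

lemma integral_polar {F : R6 → ℝ} (hF : Integrable F) :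
    ∫ x, F x = ∫ r, ∫ ξ : S5, F (r • (ξ : R6)) ∂surf ∂radialMeasure := by
  rw [← integral_prod _ (integrable_polar hF), ← measurePreserving_polar.map_eq, integral_map
    measurePreserving_polar.aemeasurable
    (by rw [measurePreserving_polar.map_eq]; exact hF.aestronglyMeasurable)]

lemma memLp_polar {F : R6 → ℝ} (hF : MemLp F 2 volume) :
    MemLp (fun q : ℝ × S5 => F (q.1 • (q.2 : R6))) 2 (radialMeasure.prod surf) :=
  hF.comp_measurePreserving measurePreserving_polar

lemma ae_memLp_sphere {F : R6 → ℝ} (hF : MemLp F 2 volume) :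
    ∀ᵐ r ∂radialMeasure, MemLp (fun ξ : S5 => F (r • (ξ : R6))) 2 surf := by
  have h := memLp_polar hF
  filter_upwards [h.integrable_sq.prod_right_ae, h.aestronglyMeasurable.prodMk_left] with r h1 h2
  exact (memLp_two_iff_integrable_sq h2).2 h1

lemma sq_integral_mul_le {u v : S5 → ℝ} (hu : MemLp u 2 surf) (hv : MemLp v 2 surf) :
    (∫ ξ, u ξ * v ξ ∂surf) ^ 2 ≤ (∫ ξ, u ξ ^ 2 ∂surf) * ∫ ξ, v ξ ^ 2 ∂surf := by
  have h := real_inner_mul_inner_self_le hu.toLp hv.toLp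
  simp only [inner_toLp] at h
  simpa only [pow_two] using h

section
variable {Y : (k : ℕ) → Fin (alpha k) → S5 → ℝ}

lemma aestronglyMeasurable_coeff {Z : S5 → ℝ} (hZ : Continuous Z) {F : R6 → ℝ}
    (hF : AEStronglyMeasurable F volume) : AEStronglyMeasurable (coeff Z F) radialMeasure := by
  unfold coeff
  have h : AEStronglyMeasurable (fun q : ℝ × S5 => F (q.1 • (q.2 : R6)) * Z q.2)
      (radialMeasure.prod surf) :=
    (hF.comp_measurePreserving measurePreserving_polar).mul
      (hZ.comp continuous_snd).aestronglyMeasurable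
  exact h.integral_prod_right'.const_mul _

lemma coeff_sq_le (hY : IsSphericalBasis Y) (k : ℕ) (j : Fin (alpha k)) {F : R6 → ℝ} {r : ℝ}
    (hF : MemLp (fun ξ : S5 => F (r • (ξ : R6))) 2 surf) :
    coeff (Y k j) F r ^ 2 ≤ 1 / Real.pi ^ 3 * ∫ ξ : S5, F (r • (ξ : R6)) ^ 2 ∂surf := by
  have h := sq_integral_mul_le hF (memLp_surf (hY.continuous k j) 2)
  have h2 : ∫ ξ, Y k j ξ ^ 2 ∂surf = Real.pi ^ 3 := by
    simpa [pow_two] using hY.orthogonal k j j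
  rw [h2] at h
  have hpi : 0 < Real.pi ^ 3 := by positivity
  rw [coeff, mul_pow]
  calc (1 / Real.pi ^ 3) ^ 2 * (∫ ξ : S5, F (r • (ξ : R6)) * Y k j ξ ∂surf) ^ 2
      ≤ (1 / Real.pi ^ 3) ^ 2 * ((∫ ξ : S5, F (r • (ξ : R6)) ^ 2 ∂surf) * Real.pi ^ 3) := by gcongr
    _ = _ := by field_simp

lemma memLp_coeff (hY : IsSphericalBasis Y) (k : ℕ) (j : Fin (alpha k)) {F : R6 → ℝ}
    (hF : MemLp F 2 volume) : MemLp (coeff (Y k j) F) 2 radialMeasure := by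
  have hm := aestronglyMeasurable_coeff (hY.continuous k j) hF.aestronglyMeasurable
  rw [memLp_two_iff_integrable_sq hm]
  refine ((memLp_polar hF).integrable_sq.integral_prod_left.const_mul (1 / Real.pi ^ 3)).mono'
    (hm.pow 2) ?_
  filter_upwards [ae_memLp_sphere hF] with r hr
  rw [Real.norm_eq_abs, abs_of_nonneg (sq_nonneg _)]
  exact coeff_sq_le hY k j hr

/-- Parseval's identity on a sphere in terms of the coefficients. -/
lemma hasSum_coeff_mul (hY : IsSphericalBasis Y) {F G : R6 → ℝ} {r : ℝ}
    (hF : MemLp (fun ξ : S5 => F (r • (ξ : R6))) 2 surf)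
    (hG : MemLp (fun ξ : S5 => G (r • (ξ : R6))) 2 surf) :
    HasSum (fun k => ∑ j, Real.pi ^ 3 * (coeff (Y k j) F r * coeff (Y k j) G r))
      (∫ ξ : S5, F (r • (ξ : R6)) * G (r • (ξ : R6)) ∂surf) := by
  have h := hasSum_integral_mul hY hF hG
  have e : ∀ k, (∑ j, 1 / Real.pi ^ 3 * ((∫ ξ : S5, F (r • (ξ : R6)) * Y k j ξ ∂surf) *
      ∫ ξ : S5, G (r • (ξ : R6)) * Y k j ξ ∂surf)) =
      ∑ j, Real.pi ^ 3 * (coeff (Y k j) F r * coeff (Y k j) G r) := by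
    intro k
    refine Finset.sum_congr rfl fun j _ => ?_
    unfold coeff
    field_simp
  simpa only [e] using h

/-- Parseval's identity for the expansion in spherical harmonics on the whole space. The sum over
the degree and the integral over the radius are interchanged by dominated convergence: by
Parseval's identity on spheres, `(|F_{k,j}|² + |G_{k,j}|²) / 2` sums to an integrable function. -/
lemma hasSum_integral_coeff_mul (hY : IsSphericalBasis Y) {F G : R6 → ℝ}
    (hF : MemLp F 2 volume) (hG : MemLp G 2 volume) :
    HasSum (fun k => ∑ j, Real.pi ^ 3 *
      ∫ r, coeff (Y k j) F r * coeff (Y k j) G r ∂radialMeasure) (∫ x, F x * G x) := by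
  have hint : ∀ k j, Integrable (fun r => coeff (Y k j) F r * coeff (Y k j) G r) radialMeasure :=
    fun k j => (memLp_coeff hY k j hF).integrable_mul (memLp_coeff hY k j hG)
  rw [integral_polar (F := fun x => F x * G x) (hF.integrable_mul hG)]
  have e : ∀ k, (∑ j, Real.pi ^ 3 * ∫ r, coeff (Y k j) F r * coeff (Y k j) G r ∂radialMeasure) =
      ∫ r, ∑ j, Real.pi ^ 3 * (coeff (Y k j) F r * coeff (Y k j) G r) ∂radialMeasure := by
    intro k
    rw [integral_finsetSum _ fun j _ => (hint k j).const_mul _]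
    exact Finset.sum_congr rfl fun j _ => (integral_const_mul _ _).symm
  simp only [e]
  have hFs := ae_memLp_sphere hF
  have hGs := ae_memLp_sphere hG
  refine hasSum_integral_of_dominated_convergence (fun k r =>
    1 / 2 * (∑ j, Real.pi ^ 3 * (coeff (Y k j) F r * coeff (Y k j) F r)
      + ∑ j, Real.pi ^ 3 * (coeff (Y k j) G r * coeff (Y k j) G r))) ?_ ?_ ?_ ?_ ?_
  · exact fun k => (integrable_finsetSum _ fun j _ => (hint k j).const_mul _).aestronglyMeasurable
  · refine fun k => .of_forall fun r => ?_
    rw [← Finset.sum_add_distrib, Finset.mul_sum]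
    refine (norm_sum_le _ _).trans (Finset.sum_le_sum fun j _ => ?_)
    have hpi : 0 < Real.pi ^ 3 := by positivity
    rw [norm_mul, Real.norm_of_nonneg hpi.le, norm_mul, Real.norm_eq_abs, Real.norm_eq_abs]
    rw [← abs_mul_abs_self (coeff (Y k j) F r), ← abs_mul_abs_self (coeff (Y k j) G r)]
    nlinarith [sq_nonneg (|coeff (Y k j) F r| - |coeff (Y k j) G r|)]
  · filter_upwards [hFs, hGs] with r h1 h2
    exact (((hasSum_coeff_mul hY h1 h1).add (hasSum_coeff_mul hY h2 h2)).mul_left _).summable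
  · refine ((((memLp_polar hF).integrable_mul (memLp_polar hF)).integral_prod_left.add
      ((memLp_polar hG).integrable_mul (memLp_polar hG)).integral_prod_left).const_mul
        (1 / 2)).congr ?_
    filter_upwards [hFs, hGs] with r h1 h2
    exact (((hasSum_coeff_mul hY h1 h1).add (hasSum_coeff_mul hY h2 h2)).mul_left
      (1 / 2 : ℝ)).tsum_eq.symm
  · filter_upwards [hFs, hGs] with r h1 h2
    exact hasSum_coeff_mul hY h1 h2
end

/-! ### The potential in spherical coordinates -/

lemma omega_pos (r : ℝ) : 0 < omega r := by unfold omega; positivity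

lemma continuous_omega : Continuous omega := by
  unfold omega
  refine continuous_const.mul (continuous_const.div (by fun_prop) fun r => ?_)
  positivity

lemma omega_le (r : ℝ) : omega r ≤ 12 / Real.pi ^ (3 / 2 : ℝ) := by
  unfold omega
  refine mul_le_of_le_one_right (by positivity) ?_
  rw [div_le_one (by positivity)]
  nlinarith [sq_nonneg r, sq_nonneg (r ^ 2)]

lemma pi_rpow_sq : (Real.pi ^ (3 / 2 : ℝ)) ^ 2 = Real.pi ^ 3 := by
  rw [← Real.rpow_natCast, ← Real.rpow_mul Real.pi_pos.le, ← Real.rpow_natCast]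
  norm_num

lemma omega_sq (r : ℝ) : omega r ^ 2 = 144 / Real.pi ^ 3 * (1 / (1 + r ^ 2) ^ 4) := by
  unfold omega
  rw [mul_pow, div_pow, pi_rpow_sq, div_pow]
  ring

lemma continuous_omega_norm : Continuous fun x : R6 => omega ‖x‖ :=
  continuous_omega.comp continuous_norm

lemma memLp_omega : MemLp (fun x : R6 => omega ‖x‖) 2 volume := by
  rw [memLp_two_iff_integrable_sq continuous_omega_norm.aestronglyMeasurable]
  have h := integrable_rpow_neg_one_add_norm_sq (E := R6) (μ := volume) (r := 8) (by simp; norm_num)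
  refine (h.const_mul (144 / Real.pi ^ 3)).congr (.of_forall fun x => ?_)
  simp only [omega_sq]
  congr 1
  rw [show (-8 / 2 : ℝ) = -((4 : ℕ) : ℝ) by norm_num, Real.rpow_neg (by positivity),
    Real.rpow_natCast, one_div]

lemma integrable_omega_mul {f : R6 → ℝ} (hf : MemLp f 2 volume) :
    Integrable (fun y => omega ‖y‖ * f y) := memLp_omega.integrable_mul hf

lemma integrable_omega_sq : Integrable (fun y : R6 => omega ‖y‖ ^ 2) := memLp_omega.integrable_sq

lemma integrable_ball_kernel :
    Integrable (fun z : R6 => (Set.Ioo (0 : ℝ) 1).indicator (fun t => 1 / t ^ 4) ‖z‖) := by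
  rw [integrable_fun_norm_addHaar (volume : Measure R6)]
  have h : IntegrableOn (fun t : ℝ => t) (Set.Ioo 0 1) :=
    (continuous_id.integrableOn_Icc (a := (0 : ℝ)) (b := 1)).mono_set Set.Ioo_subset_Icc_self
  have h2 : Integrable ((Set.Ioo (0 : ℝ) 1).indicator fun t : ℝ => t) :=
    h.integrable_indicator measurableSet_Ioo
  refine h2.integrableOn.congr (.of_forall fun t => ?_)
  by_cases ht : t ∈ Set.Ioo (0 : ℝ) 1
  · have : t ≠ 0 := ht.1.ne'
    simp [ht]
    field_simp
  · simp [ht]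

/-- The integral of `|z|⁻⁴` over the unit ball. -/
def kernelBallMass : ℝ :=
  ∫ z : R6, (Set.Ioo (0 : ℝ) 1).indicator (fun t => 1 / t ^ 4) ‖z‖

/-- The kernel is integrable near its pole, and at most `1` at distance at least `1` from it. -/
lemma norm_div_kernel_le {F : R6 → ℝ} {x : R6} {C : ℝ}
    (hC : ∀ y ∈ Metric.ball x 1, |F y| ≤ C) (y : R6) : ‖F y / ‖x - y‖ ^ 4‖ ≤
      C * (Set.Ioo (0 : ℝ) 1).indicator (fun t => 1 / t ^ 4) ‖x - y‖ + ‖F y‖ := by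
  have hC0 : 0 ≤ C := (abs_nonneg _).trans (hC x (Metric.mem_ball_self one_pos))
  rw [norm_div, norm_pow, norm_norm]
  rcases lt_or_ge ‖x - y‖ 1 with h | h
  · have hy : |F y| ≤ C := hC y (by rwa [Metric.mem_ball, dist_comm, dist_eq_norm])
    rcases (norm_nonneg (x - y)).eq_or_lt with h0 | h0
    · rw [← h0]; simp
    · rw [Set.indicator_of_mem (show ‖x - y‖ ∈ Set.Ioo (0 : ℝ) 1 from ⟨h0, h⟩), mul_one_div]
      have : ‖F y‖ / ‖x - y‖ ^ 4 ≤ C / ‖x - y‖ ^ 4 := by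
        gcongr; exact hy
      linarith [norm_nonneg (F y)]
  · rw [Set.indicator_of_notMem fun hm => absurd hm.2 (not_lt.2 h), mul_zero, zero_add]
    exact div_le_self (norm_nonneg _) (one_le_pow₀ h)

lemma aestronglyMeasurable_div_kernel {F : R6 → ℝ} (hF : AEStronglyMeasurable F volume) (x : R6) :
    AEStronglyMeasurable (fun y => F y / ‖x - y‖ ^ 4) volume := by
  have h : Measurable fun y : R6 => (‖x - y‖ ^ 4)⁻¹ := by fun_prop
  simp only [div_eq_mul_inv]
  exact hF.mul h.aestronglyMeasurable

/-- The Newtonian potential of an integrable function converges absolutely where the function is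
locally bounded. -/
lemma integrable_div_kernel {F : R6 → ℝ} (hF : Integrable F) {x : R6} {C : ℝ}
    (hC : ∀ y ∈ Metric.ball x 1, |F y| ≤ C) : Integrable (fun y => F y / ‖x - y‖ ^ 4) := by
  refine (((integrable_ball_kernel.comp_sub_left x).const_mul C).add hF.norm).mono'
    (aestronglyMeasurable_div_kernel hF.aestronglyMeasurable x) (.of_forall fun y => ?_)
  exact norm_div_kernel_le hC y

lemma abs_Phi_le {F : R6 → ℝ} (hF : Integrable F) {x : R6} {C : ℝ}
    (hC : ∀ y ∈ Metric.ball x 1, |F y| ≤ C) : |Phi F x| ≤ C * kernelBallMass + ∫ y, ‖F y‖ := by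
  have h := norm_integral_le_of_norm_le
    (((integrable_ball_kernel.comp_sub_left x).const_mul C).add hF.norm)
    (.of_forall fun y => norm_div_kernel_le hC y)
  refine h.trans_eq ?_
  simp only [Pi.add_apply]
  rw [integral_add ((integrable_ball_kernel.comp_sub_left x).const_mul C) hF.norm,
    integral_const_mul, integral_sub_left_eq_self
      (fun z : R6 => (Set.Ioo (0 : ℝ) 1).indicator (fun t => 1 / t ^ 4) ‖z‖) volume x]
  rfl

lemma kernelK_nonneg (k : ℕ) {t r : ℝ} (ht : 0 < t) (hr : 0 < r) : 0 ≤ kernelK k t r := by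
  unfold kernelK; split_ifs <;> positivity

/-- The kernel is dominated by a multiple of `t⁵ / r⁴`, uniformly in the degree. -/
lemma kernelK_le (k : ℕ) {t r : ℝ} (ht : 0 < t) (hr : 0 < r) :
    kernelK k t r ≤ Real.pi ^ 3 * t ^ 5 / r ^ 4 := by
  have h1 : 2 * Real.pi ^ 3 / ((k : ℝ) + 2) ≤ Real.pi ^ 3 := by
    rw [div_le_iff₀ (by positivity)]
    nlinarith [(by positivity : (0 : ℝ) < Real.pi ^ 3), (Nat.cast_nonneg k : (0 : ℝ) ≤ k)]
  have h2 : (if t < r then t ^ (k + 5) / r ^ (k + 4) else r ^ k / t ^ ((k : ℤ) - 1))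
      ≤ t ^ 5 / r ^ 4 := by
    split_ifs with h
    · rw [div_le_div_iff₀ (by positivity) (by positivity), pow_add, pow_add]
      have : t ^ k ≤ r ^ k := pow_le_pow_left₀ ht.le h.le k
      have h3 : 0 ≤ t ^ 5 * r ^ 4 := by positivity
      nlinarith
    · push Not at h
      rw [zpow_sub₀ ht.ne', zpow_natCast, zpow_one, div_le_div_iff₀ (by positivity) (by positivity)]
      have h4 : r ^ k ≤ t ^ k := pow_le_pow_left₀ hr.le h k
      have h5 : r ^ 4 ≤ t ^ 4 := pow_le_pow_left₀ hr.le h 4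
      calc r ^ k * r ^ 4 ≤ t ^ k * t ^ 4 := by gcongr
        _ = t ^ 5 * (t ^ k / t) := by field_simp
  unfold kernelK
  refine (mul_le_mul h1 h2 ?_ (by positivity)).trans_eq (by ring)
  split_ifs <;> positivity

lemma one_mem_sphericalHarmonics : (fun _ => 1 : S5 → ℝ) ∈ sphericalHarmonics 0 := by
  refine ⟨1, ⟨MvPolynomial.isHomogeneous_one (Fin 6) ℝ, by simp [polyLaplacian]⟩, ?_⟩
  funext ξ
  exact map_one (MvPolynomial.aeval fun i => (ξ : R6) i)

lemma exists_polar {y : R6} (hy : y ≠ 0) : ∃ η : S5, y = ‖y‖ • (η : R6) := by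
  have h : ‖y‖ ≠ 0 := norm_ne_zero_iff.2 hy
  refine ⟨⟨‖y‖⁻¹ • y, by simp [norm_smul, h]⟩, by simp [smul_smul, h]⟩

lemma norm_smul_S5 {r : ℝ} (hr : 0 < r) (ξ : S5) : ‖r • (ξ : R6)‖ = r := by
  rw [norm_smul, norm_S5, mul_one, Real.norm_of_nonneg hr.le]

lemma ae_norm_ne (r : ℝ) : ∀ᵐ y : R6, y ≠ 0 ∧ ‖y‖ ≠ r := by
  have h1 : ∀ᵐ y : R6, y ∉ Metric.sphere (0 : R6) r :=
    measure_eq_zero_iff_ae_notMem.1 (Measure.addHaar_sphere volume 0 r)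
  have h2 : ∀ᵐ y : R6, y ∉ ({0} : Set R6) :=
    measure_eq_zero_iff_ae_notMem.1 (measure_singleton 0)
  filter_upwards [h1, h2] with y h3 h4
  exact ⟨by simpa using h4, by simpa using h3⟩

lemma continuous_kernel_sphere {r : ℝ} (hr : 0 < r) {y : R6} (hy : ‖y‖ ≠ r) :
    Continuous fun ξ : S5 => 1 / ‖r • (ξ : R6) - y‖ ^ 4 := by
  refine continuous_const.div (by fun_prop) fun ξ => pow_ne_zero _ (norm_ne_zero_iff.2 ?_)
  intro h
  rw [sub_eq_zero] at h
  exact hy (by rw [← h, norm_smul_S5 hr])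

/-- By Tonelli's theorem, since the average of `|r ξ - y|⁻⁴` over the sphere is bounded in `y`. -/
lemma integrable_sphere_prod {F : R6 → ℝ} (hF : Integrable F) {r : ℝ} (hr : 0 < r) :
    Integrable (fun q : S5 × R6 => F q.2 / ‖r • (q.1 : R6) - q.2‖ ^ 4) (surf.prod volume) := by
  have hmeas : AEStronglyMeasurable (fun q : S5 × R6 => F q.2 / ‖r • (q.1 : R6) - q.2‖ ^ 4)
      (surf.prod volume) := by
    have h : Measurable fun q : S5 × R6 => (‖r • (q.1 : R6) - q.2‖ ^ 4)⁻¹ := by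
      have : Continuous fun q : S5 × R6 => ‖r • (q.1 : R6) - q.2‖ ^ 4 := by fun_prop
      exact this.measurable.inv
    simp only [div_eq_mul_inv]
    exact hF.aestronglyMeasurable.comp_snd.mul h.aestronglyMeasurable
  rw [integrable_prod_iff' hmeas]
  constructor
  · filter_upwards [ae_norm_ne r] with y hy
    simpa only [mul_one_div] using
      (integrable_surf (continuous_kernel_sphere hr hy.2)).const_mul (F y)
  · refine (hF.norm.mul_const (Real.pi ^ 3 / r ^ 4)).mono'
      (hmeas.norm.prod_swap.integral_prod_right') ?_
    filter_upwards [ae_norm_ne r] with y hy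
    obtain ⟨η, hη⟩ := exists_polar hy.1
    have hy0 : 0 < ‖y‖ := norm_pos_iff.2 hy.1
    have h1 := integral_kernel one_mem_sphericalHarmonics hr hy0 hy.2.symm η
    rw [← hη, mul_one] at h1
    have h2 : ∀ ξ : S5, ‖F y / ‖r • (ξ : R6) - y‖ ^ 4‖ = ‖F y‖ * (1 / ‖r • (ξ : R6) - y‖ ^ 4) := by
      intro ξ; rw [norm_div, norm_pow, norm_norm, mul_one_div]
    simp only [h2]
    rw [integral_const_mul, h1, norm_mul, norm_norm,
      Real.norm_of_nonneg (div_nonneg (kernelK_nonneg 0 hy0 hr) (by positivity))]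
    refine mul_le_mul_of_nonneg_left ?_ (norm_nonneg _)
    rw [div_le_iff₀ (by positivity)]
    exact (kernelK_le 0 hy0 hr).trans_eq (by ring)

/-- Potentials act on the coefficients through the radial kernel. -/
lemma coeff_Phi {Z : S5 → ℝ} {k : ℕ} (hZ : Z ∈ sphericalHarmonics k) {F : R6 → ℝ}
    (hF : Integrable F) {r : ℝ} (hr : 0 < r) :
    coeff Z (Phi F) r = ∫ t in Set.Ioi 0, kernelK k t r * coeff Z F t := by
  have hZc := continuous_of_mem_sphericalHarmonics hZ
  have hint : Integrable (fun q : S5 × R6 => F q.2 / ‖r • (q.1 : R6) - q.2‖ ^ 4 * Z q.1)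
      (surf.prod volume) := by
    obtain ⟨C, hC⟩ := isCompact_univ.exists_bound_of_continuousOn hZc.continuousOn
    exact (integrable_sphere_prod hF hr).mul_bdd (c := C)
      (hZc.comp continuous_fst).aestronglyMeasurable (.of_forall fun q => hC q.1 trivial)
  have h1 : ∫ ξ, Phi F (r • (ξ : R6)) * Z ξ ∂surf =
      ∫ y, ∫ ξ : S5, F y / ‖r • (ξ : R6) - y‖ ^ 4 * Z ξ ∂surf := by
    rw [← integral_integral_swap (f := fun (ξ : S5) y => F y / ‖r • (ξ : R6) - y‖ ^ 4 * Z ξ) hint]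
    simp only [Phi, integral_mul_const]
  rw [coeff, h1, integral_polar hint.integral_prod_right, integral_radialMeasure,
    ← integral_const_mul]
  refine setIntegral_congr_ae measurableSet_Ioi ?_
  have hne : ∀ᵐ t : ℝ, t ≠ r := by
    have := measure_eq_zero_iff_ae_notMem.1 (measure_singleton (μ := (volume : Measure ℝ)) r)
    filter_upwards [this] with t ht using by simpa using ht
  filter_upwards [hne] with t htr ht
  have ht0 : (0 : ℝ) < t := ht
  have h2 : ∀ η : S5, ∫ ξ : S5, F (t • (η : R6)) / ‖r • (ξ : R6) - t • (η : R6)‖ ^ 4 * Z ξ ∂surf =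
      kernelK k t r / t ^ 5 * (F (t • (η : R6)) * Z η) := by
    intro η
    have h3 : ∀ ξ : S5, F (t • (η : R6)) / ‖r • (ξ : R6) - t • (η : R6)‖ ^ 4 * Z ξ =
      F (t • (η : R6)) * (Z ξ / ‖r • (ξ : R6) - t • (η : R6)‖ ^ 4) := fun ξ => by ring
    simp only [h3]
    rw [integral_const_mul, integral_kernel hZ hr ht0 htr.symm]
    ring
  simp only [h2]
  rw [integral_const_mul, coeff]
  field_simp

lemma coeff_omega_mul (Z : S5 → ℝ) (f : R6 → ℝ) {t : ℝ} (ht : 0 < t) :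
    coeff Z (fun y => omega ‖y‖ * f y) t = omega t * coeff Z f t := by
  simp only [coeff, norm_smul_S5 ht, mul_assoc, integral_const_mul]
  ring

lemma coeff_Phi_omega {Z : S5 → ℝ} {k : ℕ} (hZ : Z ∈ sphericalHarmonics k) {f : R6 → ℝ}
    (hf : MemLp f 2 volume) {r : ℝ} (hr : 0 < r) :
    coeff Z (Phi fun y => omega ‖y‖ * f y) r = nonlocal k (coeff Z f) r := by
  rw [coeff_Phi hZ (integrable_omega_mul hf) hr, nonlocal]
  refine setIntegral_congr_fun measurableSet_Ioi fun t ht => ?_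
  simp only [coeff_omega_mul Z f ht, mul_assoc]

/-- The left-hand side is `π³ ∫₀^∞ t⁵ ω(t)² / max(t, r)⁴ dt`. It is evaluated with the primitives
`t⁶ / (6 (1 + t²)³)` and `- 1 / (6 (1 + t²)³)`. -/
lemma integral_omega_sq_kernel {r : ℝ} (hr : 0 < r) :
    ∫ t in Set.Ioi 0, t ^ 5 * (omega t ^ 2 * (kernelK 0 r t / r ^ 5)) =
      2 * Real.pi ^ (3 / 2 : ℝ) * omega r := by
  have hpi : 0 < Real.pi ^ 3 := by positivity
  have hd2 : ∀ t : ℝ, HasDerivAt (fun t : ℝ => -24 / (1 + t ^ 2) ^ 3)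
      (144 * t / (1 + t ^ 2) ^ 4) t := by
    intro t
    have h0 : (1 + t ^ 2) ≠ 0 := by positivity
    refine ((((hasDerivAt_pow 2 t).const_add 1).fun_pow 3).fun_inv (pow_ne_zero 3 h0)
      |>.const_mul (-24)).congr_deriv ?_
    field_simp
    ring
  have hd1 : ∀ t : ℝ, HasDerivAt (fun t : ℝ => 24 / r ^ 4 * (t ^ 6 / (1 + t ^ 2) ^ 3))
      (144 / r ^ 4 * (t ^ 5 / (1 + t ^ 2) ^ 4)) t := by
    intro t
    have h0 : (1 + t ^ 2) ≠ 0 := by positivity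
    refine (((hasDerivAt_pow 6 t).fun_div (((hasDerivAt_pow 2 t).const_add 1).fun_pow 3)
      (pow_ne_zero 3 h0)).const_mul (24 / r ^ 4)).congr_deriv ?_
    field_simp
    ring
  have hlim : Tendsto (fun t : ℝ => -24 / (1 + t ^ 2) ^ 3) atTop (𝓝 0) := by
    refine tendsto_const_nhds.div_atTop ?_
    refine (tendsto_pow_atTop (by norm_num)).comp ?_
    exact tendsto_atTop_add_const_left _ _ (tendsto_pow_atTop (by norm_num))
  have hnn : ∀ t ∈ Set.Ioi r, 0 ≤ 144 * t / (1 + t ^ 2) ^ 4 := fun t ht => by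
    have : 0 < t := hr.trans ht
    positivity
  have hI2 := integrableOn_Ioi_deriv_of_nonneg' (fun t _ => hd2 t) hnn hlim
  have hV2 := integral_Ioi_of_hasDerivAt_of_nonneg' (fun t _ => hd2 t) hnn hlim
  have hc : Continuous fun t : ℝ => 144 / r ^ 4 * (t ^ 5 / (1 + t ^ 2) ^ 4) := by
    refine continuous_const.mul (Continuous.div (by fun_prop) (by fun_prop) fun t => ?_)
    positivity
  have hV1 := intervalIntegral.integral_eq_sub_of_hasDerivAt (a := 0) (b := r) (fun t _ => hd1 t)
    (hc.intervalIntegrable 0 r)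
  rw [intervalIntegral.integral_of_le hr.le] at hV1
  have e1 : ∀ t ∈ Set.Ioc 0 r, t ^ 5 * (omega t ^ 2 * (kernelK 0 r t / r ^ 5)) =
      144 / r ^ 4 * (t ^ 5 / (1 + t ^ 2) ^ 4) := by
    intro t ht
    have ht0 : 0 < t := ht.1
    rw [omega_sq, kernelK, if_neg (not_lt.2 ht.2)]
    simp
    field_simp
  have e2 : ∀ t ∈ Set.Ioi r, t ^ 5 * (omega t ^ 2 * (kernelK 0 r t / r ^ 5)) =
      144 * t / (1 + t ^ 2) ^ 4 := by
    intro t ht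
    have ht0 : 0 < t := hr.trans ht
    rw [omega_sq, kernelK, if_pos (show r < t from ht)]
    simp
    field_simp
  have hI1' : IntegrableOn (fun t => t ^ 5 * (omega t ^ 2 * (kernelK 0 r t / r ^ 5)))
      (Set.Ioc 0 r) :=
    (hc.integrableOn_Ioc).congr_fun (fun t ht => (e1 t ht).symm) measurableSet_Ioc
  have hI2' : IntegrableOn (fun t => t ^ 5 * (omega t ^ 2 * (kernelK 0 r t / r ^ 5)))
      (Set.Ioi r) := hI2.congr_fun (fun t ht => (e2 t ht).symm) measurableSet_Ioi
  rw [← Set.Ioc_union_Ioi_eq_Ioi hr.le, setIntegral_union Set.Ioc_disjoint_Ioi_same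
    measurableSet_Ioi hI1' hI2', setIntegral_congr_fun measurableSet_Ioc e1,
    setIntegral_congr_fun measurableSet_Ioi e2, hV1, hV2]
  unfold omega
  have : Real.pi ^ (3 / 2 : ℝ) ≠ 0 := by positivity
  field_simp
  ring

/-- Away from the origin, where polar coordinates are available, `Φ(ω²) = 2 π^{3/2} ω`. -/
lemma Phi_omega_sq {x : R6} (hx : x ≠ 0) :
    Phi (fun y => omega ‖y‖ ^ 2) x = 2 * Real.pi ^ (3 / 2 : ℝ) * omega ‖x‖ := by
  obtain ⟨η, hη⟩ := exists_polar hx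
  have hr : 0 < ‖x‖ := norm_pos_iff.2 hx
  have hint : Integrable fun y : R6 => omega ‖y‖ ^ 2 / ‖x - y‖ ^ 4 := by
    refine integrable_div_kernel integrable_omega_sq (C := (12 / Real.pi ^ (3 / 2 : ℝ)) ^ 2)
      fun y _ => ?_
    rw [abs_of_nonneg (sq_nonneg _)]
    exact pow_le_pow_left₀ (omega_pos _).le (omega_le _) 2
  rw [Phi, integral_polar hint, integral_radialMeasure, ← integral_omega_sq_kernel hr]
  have hne : ∀ᵐ t : ℝ, t ≠ ‖x‖ := by
    have := measure_eq_zero_iff_ae_notMem.1 (measure_singleton (μ := (volume : Measure ℝ)) ‖x‖)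
    filter_upwards [this] with t ht using by simpa using ht
  refine setIntegral_congr_ae measurableSet_Ioi ?_
  filter_upwards [hne] with t htr ht
  have ht0 : (0 : ℝ) < t := ht
  have h1 := integral_kernel one_mem_sphericalHarmonics ht0 hr htr η
  rw [← hη, mul_one] at h1
  have e : ∀ ξ : S5, omega ‖t • (ξ : R6)‖ ^ 2 / ‖x - t • (ξ : R6)‖ ^ 4 =
      omega t ^ 2 * (1 / ‖t • (ξ : R6) - x‖ ^ 4) := by
    intro ξ
    rw [norm_smul_S5 ht0, norm_sub_rev x, mul_one_div]
  simp only [e]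
  rw [integral_const_mul, h1]

/-! ### Boundedness of the nonlocal term on square-integrable functions -/

lemma enorm_div_sq_sq (a d : ℝ) : ‖a / d ^ 2‖ₑ ^ 2 = ENNReal.ofReal (a ^ 2 / d ^ 4) := by
  rw [← ofReal_norm, ← ENNReal.ofReal_pow (norm_nonneg _), Real.norm_eq_abs, sq_abs]
  congr 1
  rw [div_pow]; ring

/-- The bound `Φ(ω²) ≤ 24`. -/
lemma lintegral_omega_kernel_le {x : R6} (hx : x ≠ 0) :
    ∫⁻ y : R6, ‖omega ‖y‖ / ‖x - y‖ ^ 2‖ₑ ^ 2 ≤ ENNReal.ofReal 24 := by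
  have hint : Integrable fun y : R6 => omega ‖y‖ ^ 2 / ‖x - y‖ ^ 4 := by
    refine integrable_div_kernel integrable_omega_sq (C := (12 / Real.pi ^ (3 / 2 : ℝ)) ^ 2)
      fun y _ => ?_
    rw [abs_of_nonneg (sq_nonneg _)]
    exact pow_le_pow_left₀ (omega_pos _).le (omega_le _) 2
  have h := Phi_omega_sq hx
  simp only [enorm_div_sq_sq]
  rw [← ofReal_integral_eq_lintegral_ofReal hint (.of_forall fun y => by positivity)]
  refine ENNReal.ofReal_le_ofReal ?_
  change Phi (fun y => omega ‖y‖ ^ 2) x ≤ 24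
  rw [h]
  have hpos : 0 < Real.pi ^ (3 / 2 : ℝ) := by positivity
  have h2 := mul_le_mul_of_nonneg_left (omega_le ‖x‖) hpos.le
  rw [mul_div_cancel₀ _ hpos.ne'] at h2
  linarith

lemma aemeasurable_enorm_div {f : R6 → ℝ} (hf : AEStronglyMeasurable f volume) (x : R6) :
    AEMeasurable (fun y => ‖f y / ‖x - y‖ ^ 2‖ₑ) volume := by
  have h : Measurable fun y : R6 => (‖x - y‖ ^ 2)⁻¹ := by fun_prop
  simp only [div_eq_mul_inv]
  exact (hf.mul h.aestronglyMeasurable).enorm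

lemma sq_lintegral_le {f : R6 → ℝ} (hf : AEStronglyMeasurable f volume) (x : R6) :
    (∫⁻ y, ‖omega ‖y‖ * f y / ‖x - y‖ ^ 4‖ₑ) ^ 2 ≤
      (∫⁻ y : R6, ‖omega ‖y‖ / ‖x - y‖ ^ 2‖ₑ ^ 2) * ∫⁻ y, ‖f y / ‖x - y‖ ^ 2‖ₑ ^ 2 := by
  have h := ENNReal.lintegral_mul_le_Lp_mul_Lq volume Real.HolderConjugate.two_two
    (aemeasurable_enorm_div continuous_omega_norm.aestronglyMeasurable x)
    (aemeasurable_enorm_div hf x)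
  have e : ∀ y : R6,
      ((fun y : R6 => ‖omega ‖y‖ / ‖x - y‖ ^ 2‖ₑ) * fun y => ‖f y / ‖x - y‖ ^ 2‖ₑ) y =
      ‖omega ‖y‖ * f y / ‖x - y‖ ^ 4‖ₑ := by
    intro y
    rw [Pi.mul_apply, ← enorm_mul, div_mul_div_comm, ← pow_add]
  simp only [e, ENNReal.rpow_two] at h
  refine (pow_le_pow_left₀ zero_le h 2).trans_eq ?_
  rw [mul_pow, ← ENNReal.rpow_two, ← ENNReal.rpow_two, ← ENNReal.rpow_mul, ← ENNReal.rpow_mul]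
  norm_num

/-- Schur's test for the kernel `ω(x) |x - y|⁻⁴ ω(y)`: the Cauchy–Schwarz bound of
`sq_lintegral_le` is integrated in `x` first, and `Φ(ω²) ≤ 24` is used in both variables. -/
lemma lintegral_schur {f : R6 → ℝ} (hf : AEStronglyMeasurable f volume) :
    ∫⁻ x, ‖omega ‖x‖‖ₑ ^ 2 * (∫⁻ y, ‖omega ‖y‖ * f y / ‖x - y‖ ^ 4‖ₑ) ^ 2 ≤
      ENNReal.ofReal 24 ^ 2 * ∫⁻ y, ‖f y‖ₑ ^ 2 := by
  have hae : ∀ᵐ x : R6, x ≠ 0 := (ae_norm_ne 0).mono fun x hx => hx.1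
  have hm : AEMeasurable (fun q : R6 × R6 => ‖omega ‖q.1‖‖ₑ ^ 2 * ‖f q.2 / ‖q.1 - q.2‖ ^ 2‖ₑ ^ 2)
      ((volume : Measure R6).prod volume) := by
    have h : Measurable fun q : R6 × R6 => (‖q.1 - q.2‖ ^ 2)⁻¹ := by fun_prop
    have h2 : AEStronglyMeasurable (fun q : R6 × R6 => f q.2 / ‖q.1 - q.2‖ ^ 2)
        ((volume : Measure R6).prod volume) := by
      simp only [div_eq_mul_inv]
      exact hf.comp_snd.mul h.aestronglyMeasurable
    have h3 : Measurable fun q : R6 × R6 => ‖omega ‖q.1‖‖ₑ ^ 2 :=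
      ((continuous_omega_norm.comp continuous_fst).measurable.enorm).pow_const 2
    exact h3.aemeasurable.mul (h2.enorm.pow_const 2)
  calc ∫⁻ x, ‖omega ‖x‖‖ₑ ^ 2 * (∫⁻ y, ‖omega ‖y‖ * f y / ‖x - y‖ ^ 4‖ₑ) ^ 2
      ≤ ∫⁻ x : R6, ENNReal.ofReal 24 *
          ∫⁻ y, ‖omega ‖x‖‖ₑ ^ 2 * ‖f y / ‖x - y‖ ^ 2‖ₑ ^ 2 := by
        refine lintegral_mono_ae ?_
        filter_upwards [hae] with x hx
        rw [lintegral_const_mul'' _ ((aemeasurable_enorm_div hf x).pow_const 2), mul_left_comm]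
        gcongr
        exact (sq_lintegral_le hf x).trans (mul_le_mul_left (lintegral_omega_kernel_le hx) _)
    _ = ENNReal.ofReal 24 *
          ∫⁻ x : R6, ∫⁻ y, ‖omega ‖x‖‖ₑ ^ 2 * ‖f y / ‖x - y‖ ^ 2‖ₑ ^ 2 :=
        lintegral_const_mul' _ _ ENNReal.ofReal_ne_top
    _ = ENNReal.ofReal 24 *
          ∫⁻ y : R6, ∫⁻ x : R6, ‖omega ‖x‖‖ₑ ^ 2 * ‖f y / ‖x - y‖ ^ 2‖ₑ ^ 2 := by
        rw [lintegral_lintegral_swap hm]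
    _ ≤ ENNReal.ofReal 24 * ∫⁻ y : R6, ‖f y‖ₑ ^ 2 * ENNReal.ofReal 24 := by
        refine mul_le_mul_right (lintegral_mono_ae ?_) _
        filter_upwards [hae] with y hy
        have e : ∀ x : R6, ‖omega ‖x‖‖ₑ ^ 2 * ‖f y / ‖x - y‖ ^ 2‖ₑ ^ 2 =
            ‖f y‖ₑ ^ 2 * ‖omega ‖x‖ / ‖y - x‖ ^ 2‖ₑ ^ 2 := by
          intro x
          rw [← mul_pow, ← mul_pow, ← enorm_mul, ← enorm_mul, norm_sub_rev x y]
          congr 2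
          ring
        simp only [e]
        rw [lintegral_const_mul' _ _ (by finiteness)]
        gcongr
        exact lintegral_omega_kernel_le hy
    _ = _ := by
        rw [lintegral_mul_const' _ _ ENNReal.ofReal_ne_top]
        ring

lemma lintegral_schur_lt_top {f : R6 → ℝ} (hf : MemLp f 2 volume) :
    ∫⁻ x, ‖omega ‖x‖‖ₑ ^ 2 * (∫⁻ y, ‖omega ‖y‖ * f y / ‖x - y‖ ^ 4‖ₑ) ^ 2 < ∞ := by
  refine (lintegral_schur hf.aestronglyMeasurable).trans_lt ?_
  have h := (eLpNorm_lt_top_iff_lintegral_rpow_enorm_lt_top two_ne_zero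
    ENNReal.ofNat_ne_top).1 hf.2
  simp only [ENNReal.toReal_ofNat, ENNReal.rpow_two] at h
  exact ENNReal.mul_lt_top (by finiteness) h

lemma aestronglyMeasurable_kernel_prod {F : R6 → ℝ} (hF : AEStronglyMeasurable F volume) :
    AEStronglyMeasurable (fun q : R6 × R6 => F q.2 / ‖q.1 - q.2‖ ^ 4)
      ((volume : Measure R6).prod volume) := by
  have h : Measurable fun q : R6 × R6 => (‖q.1 - q.2‖ ^ 4)⁻¹ := by fun_prop
  simp only [div_eq_mul_inv]
  exact hF.comp_snd.mul h.aestronglyMeasurable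

lemma ae_integrable_kernel {f : R6 → ℝ} (hf : MemLp f 2 volume) :
    ∀ᵐ x : R6, Integrable (fun y => omega ‖y‖ * f y / ‖x - y‖ ^ 4) := by
  have hF := (integrable_omega_mul hf).aestronglyMeasurable
  have hm : AEMeasurable (fun x : R6 => ‖omega ‖x‖‖ₑ ^ 2 *
      (∫⁻ y, ‖omega ‖y‖ * f y / ‖x - y‖ ^ 4‖ₑ) ^ 2) volume :=
    (continuous_omega_norm.measurable.enorm.pow_const 2).aemeasurable.mul
      ((aestronglyMeasurable_kernel_prod hF).enorm.lintegral_prod_right'.pow_const 2)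
  filter_upwards [ae_lt_top' hm (lintegral_schur_lt_top hf).ne] with x hx
  refine ⟨aestronglyMeasurable_div_kernel hF x, ?_⟩
  by_contra hcon
  have htop : ∫⁻ y, ‖omega ‖y‖ * f y / ‖x - y‖ ^ 4‖ₑ = ∞ := not_lt_top_iff.1 hcon
  rw [htop] at hx
  have h0 : ‖omega ‖x‖‖ₑ ^ 2 ≠ 0 := by
    simp [(omega_pos ‖x‖).ne']
  simp [ENNReal.mul_top h0] at hx

lemma memLp_omega_Phi {f : R6 → ℝ} (hf : MemLp f 2 volume) :
    MemLp (fun x => omega ‖x‖ * Phi (fun y => omega ‖y‖ * f y) x) 2 volume := by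
  have hF := (integrable_omega_mul hf).aestronglyMeasurable
  have hm : AEStronglyMeasurable (Phi fun y => omega ‖y‖ * f y) volume :=
    (aestronglyMeasurable_kernel_prod hF).integral_prod_right'
  refine ⟨continuous_omega_norm.aestronglyMeasurable.mul hm, ?_⟩
  rw [eLpNorm_lt_top_iff_lintegral_rpow_enorm_lt_top two_ne_zero ENNReal.ofNat_ne_top]
  simp only [ENNReal.toReal_ofNat, ENNReal.rpow_two]
  refine lt_of_le_of_lt (lintegral_mono fun x => ?_) (lintegral_schur_lt_top hf)
  rw [enorm_mul, mul_pow]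
  gcongr
  exact enorm_integral_le_lintegral_enorm _

/-! ### The Laplacian on the coefficients -/

lemma continuous_laplacian {F : R6 → ℝ} (hF : ContDiff ℝ 2 F) : Continuous (fun x => Δ F x) := by
  have h : Continuous (fderiv ℝ (fderiv ℝ F)) :=
    (hF.fderiv_right (m := 1) (by norm_num)).continuous_fderiv one_ne_zero
  simp only [laplacian_eq_sum_fderiv]
  exact continuous_finsetSum _ fun i _ => (h.clm_apply continuous_const).clm_apply continuous_const

/-- The first radial derivative of a coefficient, for `F` of class `C¹`. -/
def coeff' (Z : S5 → ℝ) (F : R6 → ℝ) (r : ℝ) : ℝ :=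
  1 / Real.pi ^ 3 * ∫ ξ : S5, fderiv ℝ F (r • (ξ : R6)) ξ * Z ξ ∂surf

/-- The second radial derivative of a coefficient, for `F` of class `C²`. -/
def coeff'' (Z : S5 → ℝ) (F : R6 → ℝ) (r : ℝ) : ℝ :=
  1 / Real.pi ^ 3 * ∫ ξ : S5, fderiv ℝ (fderiv ℝ F) (r • (ξ : R6)) ξ ξ * Z ξ ∂surf

lemma hasDerivAt_smul_S5 (ξ : S5) (r : ℝ) : HasDerivAt (fun s : ℝ => s • (ξ : R6)) (ξ : R6) r := by
  simpa using (hasDerivAt_id r).smul_const (ξ : R6)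

lemma continuous_fderiv_polar {F : R6 → ℝ} (hF : ContDiff ℝ 1 F) :
    Continuous fun q : ℝ × S5 => fderiv ℝ F (q.1 • (q.2 : R6)) q.2 :=
  ((hF.continuous_fderiv one_ne_zero).comp (by fun_prop :
    Continuous fun q : ℝ × S5 => q.1 • (q.2 : R6))).clm_apply
      (continuous_subtype_val.comp continuous_snd)

lemma continuous_fderiv_fderiv_polar {F : R6 → ℝ} (hF : ContDiff ℝ 2 F) :
    Continuous fun q : ℝ × S5 => fderiv ℝ (fderiv ℝ F) (q.1 • (q.2 : R6)) q.2 q.2 := by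
  have h : Continuous (fderiv ℝ (fderiv ℝ F)) :=
    (hF.fderiv_right (m := 1) (by norm_num)).continuous_fderiv one_ne_zero
  have h2 : Continuous fun q : ℝ × S5 => (q.2 : R6) := continuous_subtype_val.comp continuous_snd
  exact ((h.comp (by fun_prop : Continuous fun q : ℝ × S5 => q.1 • (q.2 : R6))).clm_apply
    h2).clm_apply h2

lemma hasDerivAt_coeff {Z : S5 → ℝ} (hZ : Continuous Z) {F : R6 → ℝ} (hF : ContDiff ℝ 1 F) (r : ℝ) :
    HasDerivAt (coeff Z F) (coeff' Z F r) r := by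
  refine HasDerivAt.const_mul _ (hasDerivAt_integral_surf isOpen_univ
    (G := fun r ξ => F (r • (ξ : R6)) * Z ξ)
    (G' := fun r ξ => fderiv ℝ F (r • (ξ : R6)) ξ * Z ξ) (fun s _ => ?_) ?_ (fun s _ ξ => ?_)
    (Set.mem_univ r))
  · exact (hF.continuous.comp (by fun_prop : Continuous fun ξ : S5 => s • (ξ : R6))).mul hZ
  · exact ((continuous_fderiv_polar hF).mul (hZ.comp continuous_snd)).continuousOn
  · exact (((hF.differentiable one_ne_zero _).hasFDerivAt).comp_hasDerivAt s
      (hasDerivAt_smul_S5 ξ s)).mul_const _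

lemma hasDerivAt_coeff' {Z : S5 → ℝ} (hZ : Continuous Z) {F : R6 → ℝ} (hF : ContDiff ℝ 2 F)
    (r : ℝ) : HasDerivAt (coeff' Z F) (coeff'' Z F r) r := by
  have hd : ContDiff ℝ 1 (fderiv ℝ F) := hF.fderiv_right (by norm_num)
  refine HasDerivAt.const_mul _ (hasDerivAt_integral_surf isOpen_univ
    (G := fun r ξ => fderiv ℝ F (r • (ξ : R6)) ξ * Z ξ)
    (G' := fun r ξ => fderiv ℝ (fderiv ℝ F) (r • (ξ : R6)) ξ ξ * Z ξ)
    (fun s _ => ?_) ?_ (fun s _ ξ => ?_) (Set.mem_univ r))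
  · exact ((continuous_fderiv_polar (hF.of_le one_le_two)).comp
      (by fun_prop : Continuous fun ξ : S5 => (s, ξ))).mul hZ
  · exact ((continuous_fderiv_fderiv_polar hF).mul (hZ.comp continuous_snd)).continuousOn
  · have h := ((hd.differentiable one_ne_zero _).hasFDerivAt).comp_hasDerivAt s
      (hasDerivAt_smul_S5 ξ s)
    have h2 := h.clm_apply (hasDerivAt_const s (ξ : R6))
    refine (h2.mul_const (Z ξ)).congr_deriv ?_
    simp

lemma deriv_coeff {Z : S5 → ℝ} (hZ : Continuous Z) {F : R6 → ℝ} (hF : ContDiff ℝ 1 F) :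
    deriv (coeff Z F) = coeff' Z F := funext fun r => (hasDerivAt_coeff hZ hF r).deriv

lemma deriv_deriv_coeff {Z : S5 → ℝ} (hZ : Continuous Z) {F : R6 → ℝ} (hF : ContDiff ℝ 2 F) :
    deriv (deriv (coeff Z F)) = coeff'' Z F := by
  rw [deriv_coeff hZ (hF.of_le one_le_two)]
  exact funext fun r => (hasDerivAt_coeff' hZ hF r).deriv

lemma contDiff_coeff {Z : S5 → ℝ} (hZ : Continuous Z) {F : R6 → ℝ} (hF : ContDiff ℝ 2 F) :
    ContDiff ℝ 2 (coeff Z F) := by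
  have hc : Continuous (coeff'' Z F) := by
    have h := continuousOn_integral_surf isOpen_univ
      (G := fun r ξ => fderiv ℝ (fderiv ℝ F) (r • (ξ : R6)) ξ ξ * Z ξ)
      ((continuous_fderiv_fderiv_polar hF).mul (hZ.comp continuous_snd)).continuousOn
    exact continuous_const.mul (continuousOn_univ.1 h)
  rw [show (2 : WithTop ℕ∞) = 1 + 1 by norm_num, contDiff_succ_iff_deriv]
  refine ⟨fun r => (hasDerivAt_coeff hZ (hF.of_le one_le_two) r).differentiableAt, by simp, ?_⟩
  rw [deriv_coeff hZ (hF.of_le one_le_two), contDiff_one_iff_deriv]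
  refine ⟨fun r => (hasDerivAt_coeff' hZ hF r).differentiableAt, ?_⟩
  rwa [show deriv (coeff' Z F) = coeff'' Z F from
    funext fun r => (hasDerivAt_coeff' hZ hF r).deriv]

/-- The Laplacian acts on the coefficients as the radial operator `∂ᵣ² + 5/r ∂ᵣ - k(k+4)/r²`: the
spherical part is moved onto the spherical harmonic. -/
lemma coeff_laplacian {Z : S5 → ℝ} {k : ℕ} (hZ : Z ∈ sphericalHarmonics k) {F : R6 → ℝ}
    (hF : ContDiff ℝ 2 F) {r : ℝ} (hr : 0 < r) :
    coeff Z (fun x => Δ F x) r = deriv (deriv (coeff Z F)) r + 5 / r * deriv (coeff Z F) r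
      - (k : ℝ) * (k + 4) / r ^ 2 * coeff Z F r := by
  have hZc := continuous_of_mem_sphericalHarmonics hZ
  rw [deriv_deriv_coeff hZc hF, deriv_coeff hZc (hF.of_le one_le_two)]
  obtain ⟨p, ⟨hp, hh⟩, rfl⟩ := hZ
  have hsym := integral_sphLap_mul isOpen_univ (Set.subset_univ _)
    (contDiff_smul_comp hF r).contDiffOn (contDiff_polyFun p).contDiffOn
  simp only [sphLap_smul_comp hF, sphLap_polyFun hp hh] at hsym
  have hcs : Continuous fun ξ : S5 => (r, ξ) := by fun_prop
  have h2 : Continuous fun ξ : S5 => fderiv ℝ (fderiv ℝ F) (r • (ξ : R6)) ξ ξ :=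
    (continuous_fderiv_fderiv_polar hF).comp hcs
  have h1 : Continuous fun ξ : S5 => fderiv ℝ F (r • (ξ : R6)) ξ :=
    (continuous_fderiv_polar (hF.of_le one_le_two)).comp hcs
  have h0 : Continuous fun ξ : S5 => Δ F (r • (ξ : R6)) :=
    (continuous_laplacian hF).comp (by fun_prop : Continuous fun ξ : S5 => r • (ξ : R6))
  have hpc := continuous_polyFun_S5 p
  have e1 : ∀ ξ : S5, sphLap F (r • (ξ : R6)) * polyFun p ξ =
      r ^ 2 * (Δ F (r • (ξ : R6)) * polyFun p ξ)
      - r ^ 2 * (fderiv ℝ (fderiv ℝ F) (r • (ξ : R6)) ξ ξ * polyFun p ξ)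
      - 5 * r * (fderiv ℝ F (r • (ξ : R6)) ξ * polyFun p ξ) := by
    intro ξ
    simp only [sphLap, norm_smul_S5 hr, map_smul, smul_apply, smul_eq_mul]
    ring
  have e2 : ∀ ξ : S5, F (r • (ξ : R6)) * (-((k : ℝ) * (k + 4)) * polyFun p ξ) =
      -((k : ℝ) * (k + 4)) * (F (r • (ξ : R6)) * polyFun p ξ) := fun ξ => by ring
  simp only [e1, e2] at hsym
  have i0 : Integrable (fun ξ : S5 => r ^ 2 * (Δ F (r • (ξ : R6)) * polyFun p ξ)) surf :=
    integrable_surf (continuous_const.mul (h0.mul hpc))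
  have i2 : Integrable (fun ξ : S5 =>
      r ^ 2 * (fderiv ℝ (fderiv ℝ F) (r • (ξ : R6)) ξ ξ * polyFun p ξ)) surf :=
    integrable_surf (continuous_const.mul (h2.mul hpc))
  have i1 : Integrable (fun ξ : S5 => 5 * r * (fderiv ℝ F (r • (ξ : R6)) ξ * polyFun p ξ)) surf :=
    integrable_surf (continuous_const.mul (h1.mul hpc))
  have i02 : Integrable (fun ξ : S5 => r ^ 2 * (Δ F (r • (ξ : R6)) * polyFun p ξ)
      - r ^ 2 * (fderiv ℝ (fderiv ℝ F) (r • (ξ : R6)) ξ ξ * polyFun p ξ)) surf := i0.sub i2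
  rw [integral_sub i02 i1, integral_sub i0 i2] at hsym
  simp only [integral_const_mul] at hsym
  simp only [coeff, coeff', coeff'', restrictSphere_apply]
  field_simp
  linear_combination hsym

/-! ### The decomposition in the sense of distributions -/

lemma sphereTest_eq (Z : S5 → ℝ) (F : R6 → ℝ) :
    sphereTest Z F = fun r => Real.pi ^ 3 * (r ^ 5 * coeff Z F r) := by
  funext r
  simp only [sphereTest, coeff]
  field_simp

/-- The formal adjoint of `-∂ᵣ² - 5/r ∂ᵣ` with respect to `dr`, applied to a test function
`r⁵ p`, is `r⁵ (-∂ᵣ² - 5/r ∂ᵣ) p`. -/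
lemma adjoint_sphereTest {Z : S5 → ℝ} (hZ : Continuous Z) {F : R6 → ℝ} (hF : ContDiff ℝ 2 F)
    {r : ℝ} (hr : 0 < r) :
    -(deriv (deriv (sphereTest Z F)) r) + deriv (fun s => 5 / s * sphereTest Z F s) r =
      -(Real.pi ^ 3 * r ^ 5 *
        (deriv (deriv (coeff Z F)) r + 5 / r * deriv (coeff Z F) r)) := by
  have h1 : ∀ s, HasDerivAt (coeff Z F) (coeff' Z F s) s :=
    hasDerivAt_coeff hZ (hF.of_le one_le_two)
  have h2 := hasDerivAt_coeff' hZ hF r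
  rw [deriv_deriv_coeff hZ hF, deriv_coeff hZ (hF.of_le one_le_two), sphereTest_eq]
  have e1 : deriv (fun s => Real.pi ^ 3 * (s ^ 5 * coeff Z F s)) =
      fun s => Real.pi ^ 3 * (5 * s ^ 4 * coeff Z F s + s ^ 5 * coeff' Z F s) := by
    funext s
    have h := ((hasDerivAt_pow 5 s).mul (h1 s)).const_mul (Real.pi ^ 3)
    exact h.deriv.trans (by norm_num)
  have e2 : HasDerivAt (fun s => Real.pi ^ 3 * (5 * s ^ 4 * coeff Z F s + s ^ 5 * coeff' Z F s))
      (Real.pi ^ 3 * (5 * (4 * r ^ 3) * coeff Z F r + 5 * r ^ 4 * coeff' Z F r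
        + (5 * r ^ 4 * coeff' Z F r + r ^ 5 * coeff'' Z F r))) r := by
    have h := ((((hasDerivAt_pow 4 r).const_mul 5).mul (h1 r)).add
      ((hasDerivAt_pow 5 r).mul h2)).const_mul (Real.pi ^ 3)
    exact h.congr_deriv (by norm_num)
  have e3 : HasDerivAt (fun s => 5 / s * (Real.pi ^ 3 * (s ^ 5 * coeff Z F s)))
      (Real.pi ^ 3 * (5 * (4 * r ^ 3) * coeff Z F r + 5 * r ^ 4 * coeff' Z F r)) r := by
    have h := (((hasDerivAt_pow 4 r).const_mul 5).mul (h1 r)).const_mul (Real.pi ^ 3)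
    refine (h.congr_deriv (by norm_num)).congr_of_eventuallyEq ?_
    filter_upwards [eventually_gt_nhds hr] with s hs
    simp only [Pi.mul_apply]
    field_simp
  rw [e1, e2.deriv, e3.deriv]
  field_simp
  ring

/-- The pairing of `𝓛_k f_{k,j}` with the test function is an integral against `r⁵ dr` of products
of coefficients of square integrable functions. -/
lemma weakRadialLIntegrand_eq {Z : S5 → ℝ} {k : ℕ} (hZ : Z ∈ sphericalHarmonics k)
    {f : R6 → ℝ} (hf : MemLp f 2 volume) {F : R6 → ℝ} (hF : ContDiff ℝ 2 F) {r : ℝ} (hr : 0 < r) :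
    weakRadialLIntegrand k (coeff Z f) (sphereTest Z F) r = r ^ 5 *
      (-(Real.pi ^ 3 * (coeff Z f r * coeff Z (fun x => Δ F x) r))
        - 2 * Real.pi ^ (3 / 2 : ℝ) *
          (Real.pi ^ 3 * (coeff Z f r * coeff Z (fun x => omega ‖x‖ * F x) r))
        - 2 * (Real.pi ^ 3 *
          (coeff Z (fun x => omega ‖x‖ * Phi (fun y => omega ‖y‖ * f y) x) r * coeff Z F r))) := by
  rw [weakRadialLIntegrand, adjoint_sphereTest (continuous_of_mem_sphericalHarmonics hZ) hF hr,
    coeff_laplacian hZ hF hr, coeff_omega_mul Z F hr, coeff_omega_mul Z _ hr,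
    coeff_Phi_omega hZ hf hr, sphereTest_eq]
  ring

lemma memLp_omega_mul {f : R6 → ℝ} (hf : MemLp f 2 volume) :
    MemLp (fun x => omega ‖x‖ * f x) 2 volume := by
  refine hf.of_le_mul (c := 12 / Real.pi ^ (3 / 2 : ℝ))
    (continuous_omega_norm.aestronglyMeasurable.mul hf.aestronglyMeasurable)
    (.of_forall fun x => ?_)
  rw [norm_mul, Real.norm_of_nonneg (omega_pos _).le]
  exact mul_le_mul_of_nonneg_right (omega_le _) (norm_nonneg _)

lemma memLp_laplacian (φ : 𝓢(R6, ℝ)) : MemLp (fun x => Δ (φ : R6 → ℝ) x) 2 volume :=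
  ((Δ φ : 𝓢(R6, ℝ)).memLp 2 volume).ae_eq (.of_forall fun x => SchwartzMap.laplacian_apply φ x)

lemma weakLIntegrand_ae_eq (f : R6 → ℝ) (φ : 𝓢(R6, ℝ)) :
    weakLIntegrand f φ =ᵐ[volume] fun x => -(f x * Δ (φ : R6 → ℝ) x)
      - 2 * Real.pi ^ (3 / 2 : ℝ) * (f x * (omega ‖x‖ * φ x))
      - 2 * (omega ‖x‖ * Phi (fun y => omega ‖y‖ * f y) x * φ x) := by
  filter_upwards [ae_norm_ne 0] with x hx
  rw [weakLIntegrand, Phi_omega_sq hx.1, SchwartzMap.laplacian_apply]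
  ring

lemma integrableOn_and_weakRadialL_eq {Y : (k : ℕ) → Fin (alpha k) → S5 → ℝ}
    (hY : IsSphericalBasis Y) {f : R6 → ℝ} (hf : MemLp f 2 volume)
    (φ : 𝓢(R6, ℝ)) (k : ℕ) (j : Fin (alpha k)) :
    IntegrableOn (weakRadialLIntegrand k (coeff (Y k j) f) (sphereTest (Y k j) φ)) (Set.Ioi 0) ∧
      weakRadialL k (coeff (Y k j) f) (sphereTest (Y k j) φ) =
        -(Real.pi ^ 3 *
          ∫ r, coeff (Y k j) f r * coeff (Y k j) (fun x => Δ (φ : R6 → ℝ) x) r ∂radialMeasure)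
        - 2 * Real.pi ^ (3 / 2 : ℝ) * (Real.pi ^ 3 *
          ∫ r, coeff (Y k j) f r * coeff (Y k j) (fun x => omega ‖x‖ * φ x) r ∂radialMeasure)
        - 2 * (Real.pi ^ 3 * ∫ r, coeff (Y k j)
          (fun x => omega ‖x‖ * Phi (fun y => omega ‖y‖ * f y) x) r
            * coeff (Y k j) φ r ∂radialMeasure) := by
  have hφ : MemLp φ 2 volume := φ.memLp 2 volume
  have hΔ := memLp_laplacian φ
  have i1 := (((memLp_coeff hY k j hf).integrable_mul (memLp_coeff hY k j hΔ)).const_mul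
    (Real.pi ^ 3)).neg
  have i2 := (((memLp_coeff hY k j hf).integrable_mul
    (memLp_coeff hY k j (memLp_omega_mul hφ))).const_mul (Real.pi ^ 3)).const_mul
      (2 * Real.pi ^ (3 / 2 : ℝ))
  have i3 := (((memLp_coeff hY k j (memLp_omega_Phi hf)).integrable_mul
    (memLp_coeff hY k j hφ)).const_mul (Real.pi ^ 3)).const_mul 2
  have heq : Set.EqOn (weakRadialLIntegrand k (coeff (Y k j) f) (sphereTest (Y k j) φ))
      (fun r => r ^ 5 * (-(Real.pi ^ 3 *
          (coeff (Y k j) f r * coeff (Y k j) (fun x => Δ (φ : R6 → ℝ) x) r))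
        - 2 * Real.pi ^ (3 / 2 : ℝ) * (Real.pi ^ 3 *
          (coeff (Y k j) f r * coeff (Y k j) (fun x => omega ‖x‖ * φ x) r))
        - 2 * (Real.pi ^ 3 * (coeff (Y k j)
          (fun x => omega ‖x‖ * Phi (fun y => omega ‖y‖ * f y) x) r * coeff (Y k j) φ r))))
      (Set.Ioi 0) := fun r hr => weakRadialLIntegrand_eq (hY.mem k j) hf (φ.smooth 2) hr
  refine ⟨(integrableOn_congr_fun heq measurableSet_Ioi).2
    (integrable_radialMeasure.1 ((i1.sub i2).sub i3)), ?_⟩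
  rw [weakRadialL, setIntegral_congr_fun measurableSet_Ioi heq,
    ← integral_radialMeasure fun r =>
      -(Real.pi ^ 3 * (coeff (Y k j) f r * coeff (Y k j) (fun x => Δ (φ : R6 → ℝ) x) r))
        - 2 * Real.pi ^ (3 / 2 : ℝ) * (Real.pi ^ 3 *
          (coeff (Y k j) f r * coeff (Y k j) (fun x => omega ‖x‖ * φ x) r))
        - 2 * (Real.pi ^ 3 * (coeff (Y k j)
          (fun x => omega ‖x‖ * Phi (fun y => omega ‖y‖ * f y) x) r * coeff (Y k j) φ r))]
  refine (integral_sub (i1.sub i2) i3).trans ?_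
  refine (congrArg₂ _ (integral_sub i1 i2) rfl).trans ?_
  simp only [Pi.neg_apply, Pi.mul_apply, integral_neg, integral_const_mul]

theorem weak_decomposition {Y : (k : ℕ) → Fin (alpha k) → S5 → ℝ}
    (hY : IsSphericalBasis Y) {f : R6 → ℝ} (hf : MemLp f 2 volume) (φ : 𝓢(R6, ℝ)) :
    Integrable (weakLIntegrand f φ) ∧
      HasSum (fun k => ∑ j, weakRadialL k (coeff (Y k j) f) (sphereTest (Y k j) φ))
        (weakL f φ) := by
  have hφ : MemLp φ 2 volume := φ.memLp 2 volume
  have hΔ := memLp_laplacian φ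
  have hωφ := memLp_omega_mul hφ
  have hωΦ := memLp_omega_Phi hf
  have i1 := (hf.integrable_mul hΔ).neg
  have i2 := (hf.integrable_mul hωφ).const_mul (2 * Real.pi ^ (3 / 2 : ℝ))
  have i3 := (hωΦ.integrable_mul hφ).const_mul 2
  have hae := weakLIntegrand_ae_eq f φ
  refine ⟨((i1.sub i2).sub i3).congr hae.symm, ?_⟩
  have hL : weakL f φ = -(∫ x, f x * Δ (φ : R6 → ℝ) x)
      - 2 * Real.pi ^ (3 / 2 : ℝ) * (∫ x, f x * (omega ‖x‖ * φ x))
      - 2 * ∫ x, omega ‖x‖ * Phi (fun y => omega ‖y‖ * f y) x * φ x := by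
    rw [weakL, integral_congr_ae hae]
    refine (integral_sub (i1.sub i2) i3).trans ?_
    refine (congrArg₂ _ (integral_sub i1 i2) rfl).trans ?_
    simp only [Pi.neg_apply, Pi.mul_apply, integral_neg, integral_const_mul]
  have hs := ((hasSum_integral_coeff_mul hY hf hΔ).neg.sub
    ((hasSum_integral_coeff_mul hY hf hωφ).mul_left (2 * Real.pi ^ (3 / 2 : ℝ)))).sub
    ((hasSum_integral_coeff_mul hY hωΦ hφ).mul_left 2)
  rw [hL]
  refine hs.congr_fun fun k => ?_
  simp only [(integrableOn_and_weakRadialL_eq hY hf φ k _).2, Finset.sum_sub_distrib,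
    Finset.sum_neg_distrib, Finset.mul_sum]

/-! ### Absolute convergence and the decomposition with classical derivatives -/

lemma integrable_coeff {Z : S5 → ℝ} (hZ : Continuous Z) {F : R6 → ℝ} (hF : Integrable F) :
    Integrable (coeff Z F) radialMeasure := by
  obtain ⟨C, hC⟩ := isCompact_univ.exists_bound_of_continuousOn hZ.continuousOn
  have h : Integrable (fun q : ℝ × S5 => F (q.1 • (q.2 : R6)) * Z q.2) (radialMeasure.prod surf) :=
    (integrable_polar hF).mul_bdd (c := C)
      (hZ.comp continuous_snd).aestronglyMeasurable (.of_forall fun q => hC q.2 trivial)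
  exact h.integral_prod_left.const_mul _

lemma integrableOn_nonlocal {Z : S5 → ℝ} (hZ : Continuous Z) (k : ℕ) {f : R6 → ℝ}
    (hf : MemLp f 2 volume) {r : ℝ} (hr : 0 < r) :
    IntegrableOn (fun t => kernelK k t r * omega t * coeff Z f t) (Set.Ioi 0) := by
  have h1 := integrable_radialMeasure.1 (integrable_coeff hZ (integrable_omega_mul hf))
  -- the quotient `K_k(t, r) / t⁵` is bounded
  have h2 : IntegrableOn (fun t => t ^ 5 * coeff Z (fun y => omega ‖y‖ * f y) t *
      (kernelK k t r / t ^ 5)) (Set.Ioi 0) := by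
    refine h1.mul_bdd (c := Real.pi ^ 3 / r ^ 4) ?_ ?_
    · have hm : Measurable fun t => kernelK k t r / t ^ 5 := by
        unfold kernelK
        refine (Measurable.const_mul (Measurable.ite measurableSet_Iio ?_ ?_) _).div ?_ <;> fun_prop
      exact hm.aestronglyMeasurable
    · filter_upwards [ae_restrict_mem measurableSet_Ioi] with t ht
      have ht' : 0 < t := ht
      rw [Real.norm_of_nonneg (div_nonneg (kernelK_nonneg k ht' hr) (by positivity)),
        div_le_iff₀ (by positivity)]
      exact (kernelK_le k ht' hr).trans_eq (by ring)
  refine (integrableOn_congr_fun (fun t ht => ?_) measurableSet_Ioi).1 h2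
  have ht' : 0 < t := ht
  simp only [coeff_omega_mul Z f ht']
  field_simp

/-- A continuous function times `ω` is bounded on bounded sets. -/
lemma exists_bound_omega_mul {f : R6 → ℝ} (hf : Continuous f) (R : ℝ) :
    ∃ C, ∀ x : R6, ‖x‖ ≤ R → ∀ y ∈ Metric.ball x 1, |omega ‖y‖ * f y| ≤ C := by
  obtain ⟨C, hC⟩ := (isCompact_closedBall (0 : R6) (R + 1)).exists_bound_of_continuousOn
    (continuous_omega_norm.mul hf).continuousOn
  refine ⟨C, fun x hx y hy => hC y ?_⟩
  rw [Metric.mem_ball, dist_eq_norm] at hy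
  rw [mem_closedBall_zero_iff]
  linarith [norm_le_norm_add_norm_sub' y x]

lemma integrable_kernel_of_continuous {f : R6 → ℝ} (hf : MemLp f 2 volume) (hc : Continuous f)
    (x : R6) : Integrable (fun y => omega ‖y‖ * f y / ‖x - y‖ ^ 4) := by
  obtain ⟨C, hC⟩ := exists_bound_omega_mul hc ‖x‖
  exact integrable_div_kernel (integrable_omega_mul hf) (hC x le_rfl)

lemma memLp_Phi_sphere {f : R6 → ℝ} (hf : MemLp f 2 volume) (hc : Continuous f) {r : ℝ}
    (hr : 0 < r) :
    MemLp (fun ξ : S5 => Phi (fun y => omega ‖y‖ * f y) (r • (ξ : R6))) 2 surf := by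
  obtain ⟨C, hC⟩ := exists_bound_omega_mul hc r
  exact MemLp.of_bound
    (integrable_sphere_prod (integrable_omega_mul hf) hr).integral_prod_left.aestronglyMeasurable _
    (.of_forall fun ξ => abs_Phi_le (integrable_omega_mul hf) (hC _ (norm_smul_S5 hr ξ).le))

lemma L_smul_S5 (f : R6 → ℝ) {r : ℝ} (hr : 0 < r) (ξ : S5) :
    L f (r • (ξ : R6)) = -(Δ f (r • (ξ : R6))) - 2 * Real.pi ^ (3 / 2 : ℝ) * omega r *
      f (r • (ξ : R6)) - 2 * omega r * Phi (fun y => omega ‖y‖ * f y) (r • (ξ : R6)) := by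
  have h0 : r • (ξ : R6) ≠ 0 := by
    rw [← norm_ne_zero_iff, norm_smul_S5 hr]; exact hr.ne'
  rw [L, Phi_omega_sq h0, norm_smul_S5 hr]
  ring

lemma memLp_L_sphere {f : R6 → ℝ} (hf : MemLp f 2 volume) (hc : ContDiff ℝ 2 f) {r : ℝ}
    (hr : 0 < r) : MemLp (fun ξ : S5 => L f (r • (ξ : R6))) 2 surf := by
  have hs : Continuous fun ξ : S5 => r • (ξ : R6) := by fun_prop
  simp only [L_smul_S5 f hr]
  exact ((memLp_surf ((continuous_laplacian hc).comp hs) 2).neg.sub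
    ((memLp_surf (hc.continuous.comp hs) 2).const_mul _)).sub
    ((memLp_Phi_sphere hf hc.continuous hr).const_mul _)

lemma coeff_L {Z : S5 → ℝ} {k : ℕ} (hZ : Z ∈ sphericalHarmonics k) {f : R6 → ℝ}
    (hf : MemLp f 2 volume) (hc : ContDiff ℝ 2 f) {r : ℝ} (hr : 0 < r) :
    coeff Z (L f) r = radialL k (coeff Z f) r := by
  have hZc := continuous_of_mem_sphericalHarmonics hZ
  have hs : Continuous fun ξ : S5 => r • (ξ : R6) := by fun_prop
  have e : ∀ ξ : S5, L f (r • (ξ : R6)) * Z ξ = -(Δ f (r • (ξ : R6)) * Z ξ)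
      - 2 * Real.pi ^ (3 / 2 : ℝ) * omega r * (f (r • (ξ : R6)) * Z ξ)
      - 2 * omega r * (Phi (fun y => omega ‖y‖ * f y) (r • (ξ : R6)) * Z ξ) := fun ξ => by
    rw [L_smul_S5 f hr]; ring
  have i1 : Integrable (fun ξ : S5 => -(Δ f (r • (ξ : R6)) * Z ξ)) surf :=
    (integrable_surf (((continuous_laplacian hc).comp hs).mul hZc)).neg
  have i2 : Integrable (fun ξ : S5 => 2 * Real.pi ^ (3 / 2 : ℝ) * omega r *
      (f (r • (ξ : R6)) * Z ξ)) surf :=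
    (integrable_surf ((hc.continuous.comp hs).mul hZc)).const_mul _
  have i3 : Integrable (fun ξ : S5 => 2 * omega r *
      (Phi (fun y => omega ‖y‖ * f y) (r • (ξ : R6)) * Z ξ)) surf :=
    ((memLp_Phi_sphere hf hc.continuous hr).integrable_mul (memLp_surf hZc 2)).const_mul _
  have i12 : Integrable (fun ξ : S5 => -(Δ f (r • (ξ : R6)) * Z ξ)
      - 2 * Real.pi ^ (3 / 2 : ℝ) * omega r * (f (r • (ξ : R6)) * Z ξ)) surf := i1.sub i2
  have hΔ := coeff_laplacian hZ hc hr
  have hΦ := coeff_Phi_omega hZ hf hr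
  simp only [radialL, ← hΦ]
  have h : coeff Z (L f) r = -(coeff Z (fun x => Δ f x) r)
      - 2 * Real.pi ^ (3 / 2 : ℝ) * omega r * coeff Z f r
      - 2 * omega r * coeff Z (Phi fun y => omega ‖y‖ * f y) r := by
    simp only [coeff, e]
    rw [integral_sub i12 i3, integral_sub i1 i2, integral_neg, integral_const_mul,
      integral_const_mul]
    ring
  rw [h, hΔ]
  ring

end

end Hartree

theorem theorem2p5 (Y : (k : ℕ) → Fin (Hartree.alpha k) → Hartree.S5 → ℝ)
    (hY : Hartree.IsSphericalBasis Y) (f : Hartree.R6 → ℝ) (hf : MemLp f 2 volume) :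
    -- all the objects in the decomposition are well defined
    (∀ᵐ x : Hartree.R6, Integrable (fun y => Hartree.omega ‖y‖ * f y / ‖x - y‖ ^ 4)) ∧
    (∀ᵐ r ∂(volume.restrict (Set.Ioi (0 : ℝ))),
      MemLp (fun ξ : Hartree.S5 => f (r • (ξ : Hartree.R6))) 2 Hartree.surf) ∧
    (∀ k j, MemLp (Hartree.coeff (Y k j) f) 2 Hartree.radialMeasure) ∧
    (∀ k j, ∀ r : ℝ, 0 < r → IntegrableOn
      (fun t => Hartree.kernelK k t r * Hartree.omega t * Hartree.coeff (Y k j) f t)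
      (Set.Ioi 0)) ∧
    -- the decomposition in the sense of tempered distributions
    (∀ φ : 𝓢(Hartree.R6, ℝ),
      Integrable (Hartree.weakLIntegrand f φ) ∧
      (∀ k j, IntegrableOn (Hartree.weakRadialLIntegrand k (Hartree.coeff (Y k j) f)
        (Hartree.sphereTest (Y k j) φ)) (Set.Ioi 0)) ∧
      HasSum (fun k => ∑ j, Hartree.weakRadialL k (Hartree.coeff (Y k j) f)
        (Hartree.sphereTest (Y k j) φ)) (Hartree.weakL f φ)) ∧
    -- the decomposition with classical derivatives, when `f` has them
    (ContDiff ℝ 2 f →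
      (∀ x : Hartree.R6, Integrable (fun y => Hartree.omega ‖y‖ * f y / ‖x - y‖ ^ 4)) ∧
      (∀ k j, ContDiffOn ℝ 2 (Hartree.coeff (Y k j) f) (Set.Ioi 0)) ∧
      ∀ r : ℝ, 0 < r →
        MemLp (fun ξ : Hartree.S5 => Hartree.L f (r • (ξ : Hartree.R6))) 2 Hartree.surf ∧
        Tendsto (fun N : ℕ => eLpNorm (fun ξ : Hartree.S5 =>
            Hartree.L f (r • (ξ : Hartree.R6)) - ∑ k ∈ Finset.range N, ∑ j,
              Hartree.radialL k (Hartree.coeff (Y k j) f) r * Y k j ξ) 2 Hartree.surf)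
          atTop (𝓝 0)) := by
  open Hartree in
  refine ⟨ae_integrable_kernel hf, ae_radialMeasure.1 (ae_memLp_sphere hf),
    fun k j => memLp_coeff hY k j hf,
    fun k j r hr => integrableOn_nonlocal (hY.continuous k j) k hf hr,
    fun φ => ⟨(weak_decomposition hY hf φ).1,
      fun k j => (integrableOn_and_weakRadialL_eq hY hf φ k j).1,
      (weak_decomposition hY hf φ).2⟩,
    fun hc => ⟨integrable_kernel_of_continuous hf hc.continuous,
      fun k j => (contDiff_coeff (hY.continuous k j) hc).contDiffOn, fun r hr =>
      ⟨memLp_L_sphere hf hc hr, ?_⟩⟩⟩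
  have h := Hartree.tendsto_eLpNorm_sub_sum hY (Hartree.memLp_L_sphere hf hc hr)
  refine h.congr fun N => ?_
  have hcoeff : ∀ k j, 1 / Real.pi ^ 3 *
      ∫ ξ : Hartree.S5, Hartree.L f (r • (ξ : Hartree.R6)) * Y k j ξ ∂Hartree.surf =
      Hartree.radialL k (Hartree.coeff (Y k j) f) r := fun k j =>
    Hartree.coeff_L (hY.mem k j) hf hc hr
  simp only [hcoeff]
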